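/- Let $X_1,\dots,X_n$ be i.i.d. random variables with law $D$ in a measurable space $\mathcal X$, put $S=(X_1,\dots,X_n)$, let $\Theta$ be a measurable space, let $f:\Theta\times\mathcal X\to[0,1]$ be measurable, and let $\mu_\theta=\int f(\theta,x)\,D(dx)$. Let $P_0$ be a fixed (data-independent) probability measure on $\Theta$, let $P$ be a probability kernel from $\mathcal X^n$ to $\Theta$, and write $P_n=P(S)$. For $\nu\in[0,1]$ define $$\psi_n^\star(\theta,\nu)=\max_{-\frac1{1-\nu}\le\lambda\le\frac1\nu}\ \sum_{i=1}^n\ln\bigl(1+\lambda(f(\theta,X_i)-\nu)\bigr)\in[0,\infty],\qquad \mathcal C_n=\mathrm{KL}(P_n\|P_0)+\ln\frac{\sqrt\pi\,\Gamma(n+1)}{\Gamma(n+\frac12)}$$ (with $1/0=+\infty$, $\ln 0=-\infty$, a maximum being read as a supremum, and $\mathrm{KL}(P_n\|P_0)=+\infty$ if $P_n\not\ll P_0$), and let $\mathsf{kl}(p,q)=p\ln\frac pq+(1-p)\ln\frac{1-p}{1-q}$ be the Kullback–Leibler divergence between the Bernoulli distributions with parameters $p,q\in[0,1]$. Let $\delta\in(0,1]$,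 $K=\lceil\ln(1/\delta)\rceil$ and $m\ge1$. The Monte Carlo algorithm does the following. 1. Given $S$, it draws $K$ independent blocks $(\theta_i)_{i\in B_k}\sim P_n^{\otimes m}$, where $B_k=\{(k-1)m+1,\dots,km\}$, $k=1,\dots,K$. 2. For each $k$ it computes the maximum $\bar\nu_U(k)$ and the minimum $\bar\nu_L(k)$ of $\frac1m\sum_{i\in B_k}\nu_{\theta_i}$ over all $(\nu_{\theta_i})_{i\in B_k}\in[0,1]^{B_k}$ with $$\frac1{em}\sum_{i\in B_k}\psi_n^\star(\theta_i,\nu_{\theta_i})\le\mathcal C_n+\ln\frac1\delta .$$ 3. With $\hat k_U=\arg\max_k\bar\nu_U(k)$ and $\hat k_L=\arg\min_k\bar\nu_L(k)$, it outputs $$M_U=\max\Bigl\{\mu\in[0,1]:\mathsf{kl}\bigl(\bar\nu_U(\hat k_U),\mu\bigr)\le\frac{\ln\frac{K}{2\delta}}m\Bigr\},\qquad M_L=\min\Bigl\{\mu\in[0,1]:\mathsf{kl}\bigl(\bar\nu_L(\hat k_L),\mu\bigr)\le\frac{\ln\frac{K}{2\delta}}m\Bigr\}.$$ Then, with probability at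 least $1-3\delta$ over $S$ and the sampled parameters, $$M_L\le\int\mu_\theta\,dP_n(\theta)\le M_U .$$ -/

import Mathlib

open MeasureTheory ProbabilityTheory

noncomputable section

namespace PacBayes

/-- The set of bets `λ` with `-1/(1-ν) ≤ λ ≤ 1/ν`, for `ν ∈ [0,1]`. The two inequalities are written
without division, so that `1/0` is read as `+∞` when `ν = 0` or `ν = 1`. -/
def admissibleBets (ν : ℝ) : Set ℝ :=
  {l | -1 ≤ l * (1 - ν) ∧ l * ν ≤ 1}

/-- The optimal log-wealth
`ψₙ⋆(θ, ν) = max_{-1/(1-ν) ≤ λ ≤ 1/ν} ∑ᵢ ln (1 + λ (f(θ, xᵢ) - ν))` of the parameter `θ` on the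
sample `x`. It is extended-real valued, with `ln 0 = -∞`. For an admissible `λ` all the arguments
`1 + λ (f(θ, xᵢ) - ν)` are nonnegative. -/
def optLogWealth {Θ 𝒳 : Type*} (f : Θ → 𝒳 → ℝ) {n : ℕ} (x : Fin n → 𝒳) (θ : Θ) (ν : ℝ) : EReal :=
  ⨆ l ∈ admissibleBets ν, ∑ i, ENNReal.log (ENNReal.ofReal (1 + l * (f θ (x i) - ν)))

/-- The complexity term `𝒞ₙ = KL(Q ‖ P₀) + ln (√π Γ(n+1) / Γ(n+1/2))`, with `KL(Q ‖ P₀) = +∞` when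
`Q` is not absolutely continuous with respect to `P₀`. -/
def complexity {Θ : Type*} [MeasurableSpace Θ] (n : ℕ) (Q P₀ : Measure Θ) : EReal :=
  (InformationTheory.klDiv Q P₀ : EReal) +
    ((Real.log (Real.sqrt Real.pi * Real.Gamma ((n : ℝ) + 1) / Real.Gamma ((n : ℝ) + 1 / 2)) : ℝ) :
      EReal)

/-- The feasible points `(ν_{θᵢ})ᵢ ∈ [0,1]ᵐ` of the optimization problem of one block
`θ = (θ₁, …, θₘ)` of sampled parameters:
`(1 / (e m)) ∑ᵢ ψₙ⋆(θᵢ, ν_{θᵢ}) ≤ 𝒞ₙ + ln (1/δ)`. -/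
def feasible {Θ 𝒳 : Type*} [MeasurableSpace Θ] (f : Θ → 𝒳 → ℝ) (Q P₀ : Measure Θ) (δ : ℝ) {n m : ℕ}
    (x : Fin n → 𝒳) (θ : Fin m → Θ) : Set (Fin m → ℝ) :=
  {ν | (∀ i, ν i ∈ Set.Icc (0 : ℝ) 1) ∧
    ((1 / (Real.exp 1 * (m : ℝ)) : ℝ) : EReal) * ∑ i, optLogWealth f x (θ i) (ν i) ≤
      complexity n Q P₀ + ((Real.log (1 / δ) : ℝ) : EReal)}

/-- The values `(1/m) ∑ᵢ ν_{θᵢ}` of the objective of one block over its feasible points. -/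
def blockValues {Θ 𝒳 : Type*} [MeasurableSpace Θ] (f : Θ → 𝒳 → ℝ) (Q P₀ : Measure Θ) (δ : ℝ)
    {n m : ℕ} (x : Fin n → 𝒳) (θ : Fin m → Θ) : Set ℝ :=
  (fun ν : Fin m → ℝ => 1 / (m : ℝ) * ∑ i, ν i) '' feasible f Q P₀ δ x θ

/-- The binary relative entropy `p ln (p/q) + (1-p) ln ((1-p)/(1-q))` for `p, q ∈ [0,1]`, that is the
Kullback-Leibler divergence between the Bernoulli distributions with parameters `p` and `q`. It is
`+∞` when the first distribution is not absolutely continuous with respect to the second, and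
`0 ln 0 = 0`. -/
def binaryKL (p q : ℝ) : EReal :=
  open Classical in
  if (q = 0 ∧ p ≠ 0) ∨ (q = 1 ∧ p ≠ 1) then ⊤
  else ((p * Real.log (p / q) + (1 - p) * Real.log ((1 - p) / (1 - q)) : ℝ) : EReal)

/-- The set of means `u ∈ [0,1]` with `kl(v, u) ≤ ln (K / (2δ)) / m`. -/
def klBall (δ : ℝ) (K m : ℕ) (v : ℝ) : Set ℝ :=
  {u | u ∈ Set.Icc (0 : ℝ) 1 ∧
    binaryKL v u ≤ ((Real.log ((K : ℝ) / (2 * δ)) / (m : ℝ) : ℝ) : EReal)}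

/-- The output `M_U` of the Monte Carlo procedure on the sample `x`, with posterior `Q`, prior `P₀`
and sampled parameters `θ k i` (block `k`, position `i` in the block): maximize in each block, take
the largest of the optimal values, and invert the binary relative entropy upwards. -/
def upperOutput {Θ 𝒳 : Type*} [MeasurableSpace Θ] (f : Θ → 𝒳 → ℝ) (Q P₀ : Measure Θ) (δ : ℝ)
    {n K m : ℕ} (x : Fin n → 𝒳) (θ : Fin K → Fin m → Θ) : ℝ :=
  sSup (klBall δ K m (⨆ k, sSup (blockValues f Q P₀ δ x (θ k))))

/-- The output `M_L` of the Monte Carlo procedure: minimize in each block, take the smallest of the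
optimal values, and invert the binary relative entropy downwards. -/
def lowerOutput {Θ 𝒳 : Type*} [MeasurableSpace Θ] (f : Θ → 𝒳 → ℝ) (Q P₀ : Measure Θ) (δ : ℝ)
    {n K m : ℕ} (x : Fin n → 𝒳) (θ : Fin K → Fin m → Θ) : ℝ :=
  sInf (klBall δ K m (⨅ k, sInf (blockValues f Q P₀ δ x (θ k))))

/-- The kernel `s ↦ (κ s)^{⊗ N}` of `N` independent draws from `κ s`. -/
def iidKernel {α β : Type*} [MeasurableSpace α] [MeasurableSpace β] (κ : Kernel α β)
    [IsMarkovKernel κ] (N : ℕ) : Kernel α (Fin N → β) where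
  toFun s := Measure.pi fun _ => κ s
  measurable' := by
    refine Measurable.measure_of_isPiSystem_of_isProbabilityMeasure
      generateFrom_pi.symm isPiSystem_pi ?_
    rintro _ ⟨t, ht, rfl⟩
    simp only [Measure.pi_pi]
    exact Finset.measurable_fun_prod _ fun i _ =>
      κ.measurable_coe (ht i (Set.mem_univ i))

instance {α β : Type*} [MeasurableSpace α] [MeasurableSpace β] (κ : Kernel α β)
    [IsMarkovKernel κ] (N : ℕ) : IsMarkovKernel (iidKernel κ N) :=
  ⟨fun s => by
    change IsProbabilityMeasure (Measure.pi fun _ : Fin N => κ s)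
    infer_instance⟩

end PacBayes

end

/-!
Betting against the mean `ν` of `[0,1]`-valued observations, the mixture of the constant bets with
Krichevsky–Trofimov weights loses at most a factor `√π Γ(n+1) / Γ(n+1/2)` against the best bet,
and against the true mean its wealth has expectation at most one. This holds for each parameter, so
the wealth `w` averaged over the prior also has expectation at most one. The Donsker–Varadhan
inequality bounds the posterior average of the logarithm of the wealth against the true means by
the complexity term plus `ln w`.

Given the sample, Markov's inequality makes the vector of true means infeasible in a block with
probability at most about `1/e`, and a Chernoff bound makes the block mean deviate to a given side
with probability at most `2δ/K`. An output can fail only if each of the `K` blocks is infeasible or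
deviates, so for both outputs together the failure probability is about `e⁻ᴷ ≤ δ` plus terms for
the deviations. It has an affine majorant `c₀ + c₁ w` with `c₀ + c₁ ≤ 3δ`, which is integrated over
the sample.
-/

namespace PacBayes

/-! ### Krichevsky–Trofimov weights -/

/-- The worst-case ratio between the wealth of the best constant bet on `n` outcomes and the wealth
of the Krichevsky–Trofimov mixture of bets. -/
noncomputable def regret (n : ℕ) : ℝ :=
  √Real.pi * Real.Gamma ((n : ℝ) + 1) / Real.Gamma ((n : ℝ) + 1 / 2)

/-- The Krichevsky–Trofimov weight of `k` successes and `l` failures, that is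
`∫ uᵏ (1 - u)ˡ d(Beta(1/2, 1/2))(u)`. -/
noncomputable def ktWeight (k l : ℕ) : ℝ :=
  Real.Gamma ((k : ℝ) + 1 / 2) * Real.Gamma ((l : ℝ) + 1 / 2) /
    (Real.pi * Real.Gamma (((k + l : ℕ) : ℝ) + 1))

lemma Gamma_natCast_succ_add_half (k : ℕ) :
    Real.Gamma (((k + 1 : ℕ) : ℝ) + 1 / 2) = (k + 1 / 2) * Real.Gamma ((k : ℝ) + 1 / 2) := by
  rw [← Real.Gamma_add_one (by positivity)]
  push_cast
  ring_nf

lemma regret_pos (n : ℕ) : 0 < regret n := by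
  have := Real.pi_pos
  unfold regret
  positivity

lemma regret_zero : regret 0 = 1 := by
  have h : √Real.pi ≠ 0 := (Real.sqrt_pos.2 Real.pi_pos).ne'
  rw [regret, Nat.cast_zero, zero_add, zero_add, Real.Gamma_one_half_eq, Real.Gamma_one, mul_one,
    div_self h]

lemma regret_succ (n : ℕ) : regret (n + 1) = (n + 1) / (n + 1 / 2) * regret n := by
  rw [regret, regret, Gamma_natCast_succ_add_half, Nat.cast_succ,
    Real.Gamma_add_one (s := (n : ℝ) + 1) (by positivity)]
  field_simp

lemma one_le_regret (n : ℕ) : 1 ≤ regret n := by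
  induction n with
  | zero => exact regret_zero.ge
  | succ n ih =>
    rw [regret_succ]
    refine one_le_mul_of_one_le_of_one_le ((one_le_div (by positivity)).2 ?_) ih
    linarith

lemma ktWeight_pos (k l : ℕ) : 0 < ktWeight k l := by
  have := Real.pi_pos
  unfold ktWeight
  positivity

lemma ktWeight_zero_zero : ktWeight 0 0 = 1 := by
  simp [ktWeight, Real.Gamma_one_half_eq, -one_div, Real.mul_self_sqrt Real.pi_pos.le]

lemma ktWeight_succ_left_add_succ_right (k l : ℕ) :
    ktWeight (k + 1) l + ktWeight k (l + 1) = ktWeight k l := by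
  have hden : Real.Gamma (((k + l + 1 : ℕ) : ℝ) + 1) =
      (k + l + 1) * Real.Gamma (((k + l : ℕ) : ℝ) + 1) := by
    rw [Nat.cast_succ, Real.Gamma_add_one (by positivity), Nat.cast_add]
  have := Real.pi_pos
  rw [ktWeight, ktWeight, ktWeight, Nat.add_right_comm, ← Nat.add_assoc, hden,
    Gamma_natCast_succ_add_half, Gamma_natCast_succ_add_half]
  field_simp
  ring

lemma sum_powerset_ktWeight {ι : Type*} [DecidableEq ι] (s : Finset ι) (k l : ℕ) :
    ∑ t ∈ s.powerset, ktWeight (k + t.card) (l + (s \ t).card) = ktWeight k l := by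
  induction s using Finset.induction_on generalizing k l with
  | empty => simp
  | insert a s ha ih =>
    rw [Finset.sum_powerset_insert ha, ← ktWeight_succ_left_add_succ_right k l, ← ih (k + 1) l,
      ← ih k (l + 1), add_comm]
    congr 1 <;> refine Finset.sum_congr rfl fun t ht => ?_ <;>
      have hat : a ∉ t := fun h => ha (Finset.mem_powerset.1 ht h)
    · rw [Finset.card_insert_of_notMem hat, Finset.insert_sdiff_insert,
        Finset.sdiff_insert_of_notMem ha, Nat.add_right_comm, Nat.add_assoc]
    · rw [Finset.insert_sdiff_of_notMem _ hat, Finset.card_insert_of_notMem (by simp [ha]),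
        Nat.add_right_comm l, Nat.add_assoc l]

lemma sum_ktWeight_card_compl (ι : Type*) [Fintype ι] [DecidableEq ι] :
    ∑ t : Finset ι, ktWeight t.card tᶜ.card = 1 := by
  simpa only [Finset.powerset_univ, zero_add, ← Finset.compl_eq_univ_sdiff, ktWeight_zero_zero]
    using sum_powerset_ktWeight (Finset.univ : Finset ι) 0 0

lemma natCast_pow_self_pos (n : ℕ) : 0 < (n : ℝ) ^ n := mod_cast n.pow_self_pos

lemma hasDerivAt_log_add_half_add_mul_log_sub {x : ℝ} (hx : 0 < x) :
    HasDerivAt (fun x => Real.log (x + 1 / 2) + x * Real.log x - (x + 1) * Real.log (x + 1))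
      (1 / (x + 1 / 2) - Real.log (1 + 1 / x)) x := by
  have h₁ : HasDerivAt (fun x => Real.log (x + 1 / 2)) (1 / (x + 1 / 2)) x :=
    ((hasDerivAt_id x).add_const (1 / 2)).log (by simp only [id]; positivity)
  have h₂ := Real.hasDerivAt_mul_log hx.ne'
  have h₃ := HasDerivAt.comp_add_const x 1 (Real.hasDerivAt_mul_log (by positivity))
  refine ((h₁.add h₂).sub h₃).congr_deriv ?_
  rw [one_add_div hx.ne', Real.log_div (by positivity) hx.ne']
  ring

lemma antitoneOn_log_add_half_add_mul_log_sub :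
    AntitoneOn (fun x : ℝ => Real.log (x + 1 / 2) + x * Real.log x - (x + 1) * Real.log (x + 1))
      (Set.Ici 0) := by
  refine antitoneOn_of_deriv_nonpos (convex_Ici 0) ?_ ?_ ?_
  · refine (ContinuousOn.add ?_ Real.continuous_mul_log.continuousOn).sub
      (Real.continuous_mul_log.comp (continuous_add_const 1)).continuousOn
    refine ContinuousOn.log (by fun_prop) fun x (hx : 0 ≤ x) => ?_
    positivity
  all_goals
    intro x hx
    rw [interior_Ici] at hx
    have hderiv := hasDerivAt_log_add_half_add_mul_log_sub hx
  · exact hderiv.differentiableAt.differentiableWithinAt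
  · have hx0 : 0 < x := hx
    rw [hderiv.deriv, sub_nonpos]
    calc 1 / (x + 1 / 2) = 2 * (1 / x) / (1 / x + 2) := by field_simp; ring
      _ ≤ Real.log (1 + 1 / x) := Real.le_log_one_add_of_nonneg (by positivity)

lemma antitone_add_half_mul_pow_self_div :
    Antitone fun n : ℕ => ((n : ℝ) + 1 / 2) * (n : ℝ) ^ n / ((n : ℝ) + 1) ^ (n + 1) := by
  have hlog (n : ℕ) : Real.log (((n : ℝ) + 1 / 2) * (n : ℝ) ^ n / ((n : ℝ) + 1) ^ (n + 1)) =
      Real.log ((n : ℝ) + 1 / 2) + n * Real.log n - (n + 1) * Real.log (n + 1) := by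
    have := natCast_pow_self_pos n
    rw [Real.log_div (by positivity) (by positivity), Real.log_mul (by positivity) (by positivity),
      Real.log_pow, Real.log_pow, Nat.cast_succ]
  intro l k hlk
  have hk := natCast_pow_self_pos k
  have hl := natCast_pow_self_pos l
  rw [← Real.log_le_log_iff (by positivity) (by positivity), hlog, hlog]
  exact antitoneOn_log_add_half_add_mul_log_sub (Set.mem_Ici.2 l.cast_nonneg)
    (Set.mem_Ici.2 k.cast_nonneg) (mod_cast hlk)

lemma pow_self_mul_pow_self_mul_Gamma_le (k l : ℕ) :
    (k : ℝ) ^ k * (l : ℝ) ^ l * (√Real.pi * Real.Gamma (((k + l : ℕ) : ℝ) + 1 / 2)) ≤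
      ((k + l : ℕ) : ℝ) ^ (k + l) *
        (Real.Gamma ((k : ℝ) + 1 / 2) * Real.Gamma ((l : ℝ) + 1 / 2)) := by
  induction l with
  | zero =>
    rw [Nat.add_zero, Nat.cast_zero, zero_add, pow_zero, mul_one, Real.Gamma_one_half_eq,
      mul_comm √_]
  | succ l ih =>
    have hratio := antitone_add_half_mul_pow_self_div (Nat.le_add_left l k)
    rw [div_le_div_iff₀ (by positivity) (by positivity)] at hratio
    refine le_of_mul_le_mul_right ?_
      (mul_pos (natCast_pow_self_pos l) (natCast_pow_self_pos (k + l)))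
    rw [← add_assoc, Gamma_natCast_succ_add_half, Gamma_natCast_succ_add_half, Nat.cast_succ,
      Nat.cast_succ]
    refine (Eq.trans_le ?_ (mul_le_mul ih hratio (by positivity) (by positivity))).trans_eq ?_ <;>
      ring

lemma pow_le_pow_self_mul_exp {t : ℝ} (ht : 0 ≤ t) (n : ℕ) :
    t ^ n ≤ (n : ℝ) ^ n * Real.exp (t - n) := by
  rcases Nat.eq_zero_or_pos n with rfl | hn
  · simpa using ht
  have hn' : (0 : ℝ) < n := mod_cast hn
  calc t ^ n = (n : ℝ) ^ n * (t / n) ^ n := by rw [← mul_pow, mul_div_cancel₀ _ hn'.ne']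
    _ ≤ (n : ℝ) ^ n * Real.exp (t / n - 1) ^ n := by
      gcongr
      linarith [Real.add_one_le_exp (t / n - 1)]
    _ = (n : ℝ) ^ n * Real.exp (t - n) := by
      rw [← Real.exp_nat_mul, mul_sub, mul_div_cancel₀ _ hn'.ne', mul_one]

lemma pow_mul_pow_mul_pow_self_le {b c : ℝ} (hb : 0 ≤ b) (hc : 0 ≤ c) (hbc : b + c = 1)
    (k l : ℕ) : b ^ k * c ^ l * ((k + l : ℕ) : ℝ) ^ (k + l) ≤ (k : ℝ) ^ k * (l : ℝ) ^ l := by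
  set s : ℝ := ((k + l : ℕ) : ℝ) with hs
  have : 0 ≤ s := Nat.cast_nonneg _
  have hexponent : (b * s - k) + (c * s - l) = 0 := by
    rw [sub_add_sub_comm, ← add_mul, hbc, one_mul, hs, Nat.cast_add, sub_self]
  calc b ^ k * c ^ l * s ^ (k + l) = (b * s) ^ k * (c * s) ^ l := by ring
    _ ≤ ((k : ℝ) ^ k * Real.exp (b * s - k)) * ((l : ℝ) ^ l * Real.exp (c * s - l)) := by
      gcongr <;> exact pow_le_pow_self_mul_exp (by positivity) _
    _ = (k : ℝ) ^ k * (l : ℝ) ^ l * Real.exp ((b * s - k) + (c * s - l)) := by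
      rw [Real.exp_add]; ring
    _ = (k : ℝ) ^ k * (l : ℝ) ^ l := by rw [hexponent, Real.exp_zero, mul_one]

lemma pow_mul_pow_le_regret_mul_ktWeight {b c : ℝ} (hb : 0 ≤ b) (hc : 0 ≤ c) (hbc : b + c = 1)
    (k l : ℕ) : b ^ k * c ^ l ≤ regret (k + l) * ktWeight k l := by
  have : 0 < √Real.pi := Real.sqrt_pos.2 Real.pi_pos
  have hprod : regret (k + l) * ktWeight k l =
      Real.Gamma ((k : ℝ) + 1 / 2) * Real.Gamma ((l : ℝ) + 1 / 2) /
        (√Real.pi * Real.Gamma (((k + l : ℕ) : ℝ) + 1 / 2)) := by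
    rw [regret, ktWeight]
    nth_rw 2 [← Real.mul_self_sqrt Real.pi_pos.le]
    field_simp
  rw [hprod, le_div_iff₀ (by positivity)]
  refine le_of_mul_le_mul_left ?_ (natCast_pow_self_pos (k + l))
  refine le_trans ?_ (pow_self_mul_pow_self_mul_Gamma_le k l)
  rw [← mul_assoc, mul_comm (_ ^ (k + l))]
  exact mul_le_mul_of_nonneg_right (pow_mul_pow_mul_pow_self_le hb hc hbc k l) (by positivity)

/-! ### The Krichevsky–Trofimov wealth -/

/-- The wealth of the Krichevsky–Trofimov mixture of bets on the outcomes `y` against the mean `ν`,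
expanded over the set `t` of outcomes that are counted as successes. For `ν ∈ {0, 1}` the
conventions of `ℝ≥0∞` make it infinite as soon as some outcome differs from `ν`. -/
noncomputable def ktWealth {ι : Type*} [Fintype ι] [DecidableEq ι] (ν : ℝ) (y : ι → ℝ) : ENNReal :=
  ∑ t : Finset ι, ENNReal.ofReal (ktWeight t.card tᶜ.card) *
    ((∏ i ∈ t, ENNReal.ofReal (y i) / ENNReal.ofReal ν) *
      ∏ i ∈ tᶜ, ENNReal.ofReal (1 - y i) / ENNReal.ofReal (1 - ν))

lemma lintegral_prod_eval_pi {ι : Type*} [Fintype ι] {α : ι → Type*}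
    [∀ i, MeasurableSpace (α i)] (μ : ∀ i, Measure (α i)) [∀ i, IsProbabilityMeasure (μ i)]
    {g : ∀ i, α i → ENNReal} (hg : ∀ i, Measurable (g i)) :
    ∫⁻ x, ∏ i, g i (x i) ∂(Measure.pi μ) = ∏ i, ∫⁻ a, g i a ∂(μ i) := by
  have hindep : iIndepFun (fun i x => g i (x i)) (Measure.pi μ) :=
    iIndepFun_pi fun i => (hg i).aemeasurable
  rw [lintegral_prod_eq_prod_lintegral_of_indepFun Finset.univ _ hindep
    fun i => (hg i).comp (measurable_pi_apply i)]
  exact Finset.prod_congr rfl fun i _ => (measurePreserving_eval μ i).lintegral_comp (hg i)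

section KTWealth

variable {ι : Type*} [Fintype ι] [DecidableEq ι]

lemma measurable_ktWealth {α : Type*} [MeasurableSpace α] {ν : α → ℝ} {y : α → ι → ℝ}
    (hν : Measurable ν) (hy : ∀ i, Measurable fun a => y a i) :
    Measurable fun a => ktWealth (ν a) (y a) := by
  unfold ktWealth
  fun_prop

lemma ofReal_pow_mul_ofReal_pow_le {ν a b : ℝ} (hν : ν ∈ Set.Icc (0 : ℝ) 1) (ha : 0 ≤ a)
    (hb : 0 ≤ b) (hab : ν * a + (1 - ν) * b = 1) (k l : ℕ) :
    ENNReal.ofReal a ^ k * ENNReal.ofReal b ^ l ≤ ENNReal.ofReal (regret (k + l)) *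
      (ENNReal.ofReal (ktWeight k l) *
        ((ENNReal.ofReal ν)⁻¹ ^ k * (ENNReal.ofReal (1 - ν))⁻¹ ^ l)) := by
  have hν0 := hν.1
  have hν1 := sub_nonneg.2 hν.2
  have hpos := mul_pos (regret_pos (k + l)) (ktWeight_pos k l)
  rw [← mul_assoc, ← ENNReal.ofReal_mul (regret_pos _).le, ← ENNReal.inv_pow, ← ENNReal.inv_pow,
    ← ENNReal.mul_inv (Or.inr (by finiteness)) (Or.inl (by finiteness)), ← div_eq_mul_inv,
    ENNReal.le_div_iff_mul_le (Or.inr (by simpa using hpos)) (Or.inr (by finiteness)),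
    mul_mul_mul_comm, ← mul_pow, ← mul_pow, ← ENNReal.ofReal_mul ha, ← ENNReal.ofReal_mul hb,
    ← ENNReal.ofReal_pow (by positivity), ← ENNReal.ofReal_pow (by positivity),
    ← ENNReal.ofReal_mul (by positivity), mul_comm a, mul_comm b]
  exact ENNReal.ofReal_le_ofReal
    (pow_mul_pow_le_regret_mul_ktWeight (by positivity) (by positivity) hab k l)

lemma prod_ofReal_one_add_le_regret_mul_ktWealth {ν : ℝ} (hν : ν ∈ Set.Icc (0 : ℝ) 1)
    {y : ι → ℝ} (hy : ∀ i, y i ∈ Set.Icc (0 : ℝ) 1) {l : ℝ} (hl : l ∈ admissibleBets ν) :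
    ∏ i, ENNReal.ofReal (1 + l * (y i - ν)) ≤
      ENNReal.ofReal (regret (Fintype.card ι)) * ktWealth ν y := by
  have ha : 0 ≤ 1 + l * (1 - ν) := by linarith [hl.1]
  have hb : 0 ≤ 1 - l * ν := by linarith [hl.2]
  have hchord (i : ι) : ENNReal.ofReal (1 + l * (y i - ν)) =
      ENNReal.ofReal (y i) * ENNReal.ofReal (1 + l * (1 - ν)) +
        ENNReal.ofReal (1 - y i) * ENNReal.ofReal (1 - l * ν) := by
    have hy0 := (hy i).1
    have hy1 := sub_nonneg.2 (hy i).2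
    rw [← ENNReal.ofReal_mul hy0, ← ENNReal.ofReal_mul hy1,
      ← ENNReal.ofReal_add (by positivity) (by positivity)]
    ring_nf
  simp_rw [hchord, Fintype.prod_add, Finset.prod_mul_distrib, Finset.prod_const]
  rw [ktWealth, Finset.mul_sum]
  refine Finset.sum_le_sum fun t _ => ?_
  have hterm := ofReal_pow_mul_ofReal_pow_le hν ha hb (by ring) t.card tᶜ.card
  rw [Finset.card_add_card_compl] at hterm
  simp_rw [div_eq_mul_inv, Finset.prod_mul_distrib, Finset.prod_const]
  rw [mul_mul_mul_comm]
  exact (mul_le_mul_right hterm _).trans_eq (by ring)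

lemma one_le_regret_mul_ktWealth {ν : ℝ} (hν : ν ∈ Set.Icc (0 : ℝ) 1) {y : ι → ℝ}
    (hy : ∀ i, y i ∈ Set.Icc (0 : ℝ) 1) :
    1 ≤ ENNReal.ofReal (regret (Fintype.card ι)) * ktWealth ν y := by
  simpa using prod_ofReal_one_add_le_regret_mul_ktWealth hν hy (l := 0) (by simp [admissibleBets])

lemma log_prod_eq_sum_log {κ : Type*} (s : Finset κ) (a : κ → ENNReal) :
    ENNReal.log (∏ i ∈ s, a i) = ∑ i ∈ s, ENNReal.log (a i) := by
  classical
  induction s using Finset.induction_on with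
  | empty => simp
  | insert i s hi ih => rw [Finset.prod_insert hi, Finset.sum_insert hi, ENNReal.log_mul_add, ih]

lemma optLogWealth_le_log_regret_mul_ktWealth {Θ 𝒳 : Type*} {f : Θ → 𝒳 → ℝ}
    (hf01 : ∀ θ x, f θ x ∈ Set.Icc (0 : ℝ) 1) {n : ℕ} (x : Fin n → 𝒳) (θ : Θ) {ν : ℝ}
    (hν : ν ∈ Set.Icc (0 : ℝ) 1) :
    optLogWealth f x θ ν ≤
      ENNReal.log (ENNReal.ofReal (regret n) * ktWealth ν fun i => f θ (x i)) := by
  refine iSup₂_le fun l hl => ?_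
  rw [← log_prod_eq_sum_log]
  simpa only [Fintype.card_fin] using ENNReal.log_le_log
    (prod_ofReal_one_add_le_regret_mul_ktWealth hν (fun i => hf01 θ (x i)) hl)

lemma lintegral_prod_mul_prod_compl_pi {α : Type*} [MeasurableSpace α] (μ : Measure α)
    [IsProbabilityMeasure μ] {g h : α → ENNReal} (hg : Measurable g) (hh : Measurable h)
    (t : Finset ι) :
    ∫⁻ x, (∏ i ∈ t, g (x i)) * ∏ i ∈ tᶜ, h (x i) ∂(Measure.pi fun _ : ι => μ) =
      (∫⁻ a, g a ∂μ) ^ t.card * (∫⁻ a, h a ∂μ) ^ tᶜ.card := by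
  have hsplit (x : ι → α) : (∏ i ∈ t, g (x i)) * ∏ i ∈ tᶜ, h (x i) =
      ∏ i, (if i ∈ t then g else h) (x i) := by
    rw [← Finset.prod_mul_prod_compl t fun i => (if i ∈ t then g else h) (x i)]
    congr 1 <;> refine Finset.prod_congr rfl fun i hi => ?_
    · rw [if_pos hi]
    · rw [if_neg (Finset.mem_compl.1 hi)]
  have hfactor (i : ι) : ∫⁻ a, (if i ∈ t then g else h) a ∂μ =
      if i ∈ t then ∫⁻ a, g a ∂μ else ∫⁻ a, h a ∂μ := by
    split_ifs <;> rfl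
  simp_rw [hsplit]
  rw [lintegral_prod_eval_pi (fun _ => μ) fun i => by split_ifs <;> assumption]
  simp only [hfactor, Finset.prod_ite, Finset.prod_const, Finset.filter_univ_mem,
    Finset.filter_notMem_eq_sdiff, ← Finset.compl_eq_univ_sdiff]

lemma lintegral_ofReal_div_ofReal_integral_le_one {α : Type*} [MeasurableSpace α] {μ : Measure α}
    {g : α → ℝ} (hg : Measurable g) (hint : Integrable g μ) (hg0 : ∀ a, 0 ≤ g a) :
    ∫⁻ a, ENNReal.ofReal (g a) / ENNReal.ofReal (∫ a, g a ∂μ) ∂μ ≤ 1 := by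
  simp_rw [div_eq_mul_inv]
  rw [lintegral_mul_const _ (by fun_prop), ← ofReal_integral_eq_lintegral_ofReal hint
    (Filter.Eventually.of_forall hg0), ← div_eq_mul_inv]
  exact ENNReal.div_self_le_one

lemma lintegral_ktWealth_le_one {α : Type*} [MeasurableSpace α] (μ : Measure α)
    [IsProbabilityMeasure μ] {g : α → ℝ} (hg : Measurable g)
    (hg01 : ∀ a, g a ∈ Set.Icc (0 : ℝ) 1) :
    ∫⁻ x, ktWealth (∫ a, g a ∂μ) (fun i => g (x i)) ∂(Measure.pi fun _ : ι => μ) ≤ 1 := by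
  have hint : Integrable g μ := .of_mem_Icc 0 1 hg.aemeasurable (.of_forall hg01)
  have hsuccess := lintegral_ofReal_div_ofReal_integral_le_one hg hint fun a => (hg01 a).1
  have hfailure := lintegral_ofReal_div_ofReal_integral_le_one (g := fun a => 1 - g a)
    (by fun_prop) ((integrable_const 1).sub hint) fun a => sub_nonneg.2 (hg01 a).2
  rw [integral_sub (integrable_const 1) hint, integral_const, probReal_univ, one_smul] at hfailure
  unfold ktWealth
  rw [lintegral_finsetSum _ fun t _ => by fun_prop]
  calc _ ≤ ∑ t : Finset ι, ENNReal.ofReal (ktWeight t.card tᶜ.card) := by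
        refine Finset.sum_le_sum fun t _ => ?_
        rw [lintegral_const_mul _ (by fun_prop),
          lintegral_prod_mul_prod_compl_pi (g := fun a => ENNReal.ofReal (g a) / _)
            (h := fun a => ENNReal.ofReal (1 - g a) / _) μ (by fun_prop) (by fun_prop)]
        exact mul_le_of_le_one_right'
          (mul_le_one' (pow_le_one' hsuccess _) (pow_le_one' hfailure _))
    _ = 1 := by
        rw [← ENNReal.ofReal_sum_of_nonneg fun t _ => (ktWeight_pos _ _).le,
          sum_ktWeight_card_compl, ENNReal.ofReal_one]

end KTWealth

/-! ### The Donsker–Varadhan inequality -/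

/-- The positive part of the extended logarithm, as a function `[0, ∞] → [0, ∞]`. -/
noncomputable def posLog (z : ENNReal) : ENNReal := (ENNReal.log z).toENNReal

@[fun_prop]
lemma measurable_posLog : Measurable posLog :=
  measurable_ereal_toENNReal.comp ENNReal.measurable_log

lemma posLog_mul_le (y z : ENNReal) : posLog (y * z) ≤ posLog y + posLog z := by
  rw [posLog, ENNReal.log_mul_add]
  exact EReal.toENNReal_add_le

lemma posLog_top : posLog ⊤ = ⊤ := by simp [posLog]

lemma posLog_ofReal {x : ℝ} (hx : 0 < x) :
    posLog (ENNReal.ofReal x) = ENNReal.ofReal (Real.log x) := by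
  rw [posLog, ENNReal.log_ofReal_of_pos hx, EReal.real_coe_toENNReal]

lemma posLog_ofReal_eq_ofReal_posLog {x : ℝ} (hx : 0 ≤ x) :
    posLog (ENNReal.ofReal x) = ENNReal.ofReal (Real.posLog x) := by
  rcases hx.eq_or_lt with rfl | hx
  · simp [posLog]
  · simp [posLog_ofReal hx, Real.posLog]

lemma log_le_posLog (z : ENNReal) : ENNReal.log z ≤ (posLog z : EReal) := by
  rw [posLog, EReal.coe_toENNReal_eq_max]
  exact le_max_right _ _

lemma mul_add_one_le_klFun_add_exp {q : ℝ} (hq : 0 ≤ q) (z : ℝ) :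
    q * z + 1 ≤ InformationTheory.klFun q + Real.exp z := by
  rw [InformationTheory.klFun_apply]
  rcases hq.eq_or_lt with rfl | hq
  · simpa using (Real.exp_pos z).le
  have hlog := mul_le_mul_of_nonneg_left (Real.add_one_le_exp (z - Real.log q)) hq.le
  rw [Real.exp_sub, Real.exp_log hq, mul_div_cancel₀ _ hq.ne'] at hlog
  linarith

lemma mul_posLog_add_one_le {q : ENNReal} (hq : q ≠ ⊤) {y : ENNReal} (hy : 1 ≤ y) {M : ℝ}
    (hM : 1 ≤ M) :
    q * posLog y + 1 ≤ ENNReal.ofReal (InformationTheory.klFun q.toReal) + y / ENNReal.ofReal M +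
      q * ENNReal.ofReal (Real.log M) := by
  have hM0 : 0 < M := by linarith
  rcases eq_or_ne y ⊤ with rfl | hyt
  · simp [ENNReal.top_div_of_ne_top]
  lift q to NNReal using hq
  lift y to NNReal using hyt
  have hy1 : (1 : ℝ) ≤ y := mod_cast hy
  have hy0 : (0 : ℝ) < y := by linarith
  have hk := InformationTheory.klFun_nonneg q.coe_nonneg
  have hly := Real.log_nonneg hy1
  have hlM := Real.log_nonneg hM
  rw [← ENNReal.ofReal_coe_nnreal (p := y), posLog_ofReal hy0, ENNReal.coe_toReal,
    ← ENNReal.ofReal_coe_nnreal (p := q), ← ENNReal.ofReal_mul q.coe_nonneg,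
    ← ENNReal.ofReal_mul q.coe_nonneg, ← ENNReal.ofReal_div_of_pos hM0, ← ENNReal.ofReal_one,
    ← ENNReal.ofReal_add (by positivity) zero_le_one, ← ENNReal.ofReal_add hk (by positivity),
    ← ENNReal.ofReal_add (by positivity) (by positivity)]
  refine ENNReal.ofReal_le_ofReal ?_
  have hyoung := mul_add_one_le_klFun_add_exp q.coe_nonneg (Real.log (y / M))
  rw [Real.exp_log (by positivity), Real.log_div hy0.ne' hM0.ne'] at hyoung
  linarith

lemma lintegral_posLog_le_klDiv_add_posLog {α : Type*} [MeasurableSpace α] (μ ν : Measure α)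
    [IsProbabilityMeasure μ] [IsProbabilityMeasure ν] {V : α → ENNReal} (hV : Measurable V)
    (hV1 : ∀ a, 1 ≤ V a) :
    ∫⁻ a, posLog (V a) ∂μ ≤ InformationTheory.klDiv μ ν + posLog (∫⁻ a, V a ∂ν) := by
  by_cases hac : μ ≪ ν
  swap
  · simp [InformationTheory.klDiv_of_not_ac hac]
  rcases eq_or_ne (∫⁻ a, V a ∂ν) ⊤ with hM | hM
  · simp [hM, posLog_top]
  have hM1 : 1 ≤ ∫⁻ a, V a ∂ν := by simpa using lintegral_mono (μ := ν) hV1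
  obtain ⟨M, hMr⟩ : ∃ r : ℝ, ∫⁻ a, V a ∂ν = ENNReal.ofReal r :=
    ⟨_, (ENNReal.ofReal_toReal hM).symm⟩
  have hM1' : 1 ≤ M := by simpa [hMr] using hM1
  have hM0 : 0 < M := by linarith
  have hdensity := μ.measurable_rnDeriv ν
  have := InformationTheory.measurable_klFun
  rw [hMr, posLog_ofReal hM0]
  refine (ENNReal.add_le_add_iff_right ENNReal.one_ne_top).1 ?_
  calc ∫⁻ a, posLog (V a) ∂μ + 1
      = ∫⁻ a, (μ.rnDeriv ν a * posLog (V a) + 1) ∂ν := by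
        rw [lintegral_add_right _ measurable_const, lintegral_rnDeriv_mul hac (by fun_prop),
          lintegral_const, measure_univ, mul_one]
    _ ≤ ∫⁻ a, (ENNReal.ofReal (InformationTheory.klFun (μ.rnDeriv ν a).toReal) +
          V a / ENNReal.ofReal M + μ.rnDeriv ν a * ENNReal.ofReal (Real.log M)) ∂ν := by
        refine lintegral_mono_ae ?_
        filter_upwards [Measure.rnDeriv_ne_top μ ν] with a ha
        exact mul_posLog_add_one_le ha (hV1 a) hM1'
    _ = InformationTheory.klDiv μ ν + 1 + ENNReal.ofReal (Real.log M) := by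
        simp_rw [div_eq_mul_inv]
        rw [lintegral_add_left (by fun_prop), lintegral_add_left (by fun_prop),
          lintegral_mul_const _ hdensity, lintegral_mul_const _ hV, hMr,
          ENNReal.mul_inv_cancel (by simpa using hM0) ENNReal.ofReal_ne_top,
          Measure.lintegral_rnDeriv hac, measure_univ, one_mul,
          InformationTheory.klDiv_eq_lintegral_klFun_of_ac hac]
    _ = InformationTheory.klDiv μ ν + ENNReal.ofReal (Real.log M) + 1 := add_right_comm _ _ _

/-! ### The binary relative entropy -/

/-- The binary relative entropy as a real number, written as cross entropy minus entropy so that it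
is visibly continuous in `p`; it agrees with `binaryKL` for `q ∈ (0, 1)`. -/
noncomputable def binaryKLReal (p q : ℝ) : ℝ :=
  -Real.binEntropy p - p * Real.log q - (1 - p) * Real.log (1 - q)

lemma binaryKL_eq_coe_binaryKLReal {p q : ℝ} (hq : q ∈ Set.Ioo (0 : ℝ) 1) :
    binaryKL p q = (binaryKLReal p q : EReal) := by
  have hlog (a : ℝ) {b : ℝ} (hb : b ≠ 0) :
      a * Real.log (a / b) = a * Real.log a - a * Real.log b := by
    rcases eq_or_ne a 0 with rfl | ha
    · simp
    · rw [Real.log_div ha hb, mul_sub]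
  have hfinite : ¬((q = 0 ∧ p ≠ 0) ∨ (q = 1 ∧ p ≠ 1)) := by
    simp [hq.1.ne', hq.2.ne]
  rw [binaryKL, if_neg hfinite, hlog p hq.1.ne', hlog (1 - p) (sub_pos.2 hq.2).ne', binaryKLReal,
    Real.binEntropy, Real.log_inv, Real.log_inv]
  congr 1
  ring

lemma binaryKL_self (p : ℝ) : binaryKL p p = 0 := by
  have hlog (a : ℝ) : a * Real.log (a / a) = 0 := by
    rcases eq_or_ne a 0 with rfl | ha
    · simp
    · simp [div_self ha]
  rw [binaryKL, if_neg (by tauto), hlog, hlog, add_zero, EReal.coe_zero]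

lemma binaryKL_one_sub_one_sub (p q : ℝ) : binaryKL (1 - p) (1 - q) = binaryKL p q := by
  simp only [binaryKL, sub_sub_cancel, sub_eq_zero, sub_eq_self, @eq_comm ℝ 1, ne_eq,
    or_comm (a := q = 1 ∧ _), add_comm ((1 - p) * _)]

lemma measurable_binaryKL {α : Type*} [MeasurableSpace α] {p q : α → ℝ} (hp : Measurable p)
    (hq : Measurable q) : Measurable fun a => binaryKL (p a) (q a) := by
  unfold binaryKL
  have hlevel {r : α → ℝ} (hr : Measurable r) (c : ℝ) : MeasurableSet {a | r a = c} :=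
    hr (measurableSet_singleton c)
  refine Measurable.ite ?_ measurable_const (by fun_prop)
  exact ((hlevel hq 0).inter (hlevel hp 0).compl).union
    ((hlevel hq 1).inter (hlevel hp 1).compl)

lemma continuous_binaryKLReal_left (q : ℝ) : Continuous fun p => binaryKLReal p q := by
  unfold binaryKLReal
  have := Real.binEntropy_continuous
  fun_prop

lemma binaryKLReal_self (q : ℝ) : binaryKLReal q q = 0 := by
  rw [binaryKLReal, Real.binEntropy, Real.log_inv, Real.log_inv]
  ring

lemma hasDerivAt_binaryKLReal_left {p : ℝ} (hp : p ∈ Set.Ioo (0 : ℝ) 1) (q : ℝ) :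
    HasDerivAt (fun p => binaryKLReal p q)
      (Real.log p - Real.log q - (Real.log (1 - p) - Real.log (1 - q))) p := by
  have hentropy := Real.hasDerivAt_binEntropy hp.1.ne' hp.2.ne
  have hsuccess := (hasDerivAt_id p).mul_const (Real.log q)
  have hfailure := ((hasDerivAt_id p).const_sub 1).mul_const (Real.log (1 - q))
  exact ((hentropy.neg.sub hsuccess).sub hfailure).congr_deriv (by ring)

lemma antitoneOn_binaryKLReal_left {q : ℝ} (hq : q < 1) :
    AntitoneOn (fun p => binaryKLReal p q) (Set.Icc 0 q) := by
  have hderiv (p : ℝ) (hp : p ∈ interior (Set.Icc 0 q)) :=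
    hasDerivAt_binaryKLReal_left (Set.Ioo_subset_Ioo_right hq.le (interior_Icc.subset hp)) q
  refine antitoneOn_of_deriv_nonpos (convex_Icc 0 q) (continuous_binaryKLReal_left q).continuousOn
    (fun p hp => (hderiv p hp).differentiableAt.differentiableWithinAt) fun p hp => ?_
  rw [(hderiv p hp).deriv]
  rw [interior_Icc] at hp
  have hsuccess := Real.log_le_log hp.1 hp.2.le
  have hfailure := Real.log_le_log (sub_pos.2 hq) (sub_le_sub_left hp.2.le 1)
  linarith

lemma antitoneOn_binaryKL_left {q : ℝ} (hq : q ≤ 1) :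
    AntitoneOn (fun p => binaryKL p q) (Set.Icc 0 q) := by
  intro p hp p' hp' hpp'
  rcases hpp'.eq_or_lt with rfl | hlt
  · exact le_rfl
  rcases hq.eq_or_lt with rfl | hq1
  · have htop : binaryKL p 1 = ⊤ := if_pos (Or.inr ⟨rfl, (hlt.trans_le hp'.2).ne⟩)
    exact le_top.trans_eq htop.symm
  · have hqmem : q ∈ Set.Ioo (0 : ℝ) 1 := ⟨(hp.1.trans_lt hlt).trans_le hp'.2, hq1⟩
    simp only [binaryKL_eq_coe_binaryKLReal hqmem, EReal.coe_le_coe_iff]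
    exact antitoneOn_binaryKLReal_left hq1 hp hp' hpp'

/-! ### Block means and their Chernoff bound -/

/-- The mean of the values `ν` over a block of size `m`. -/
noncomputable def blockMean {m : ℕ} (ν : Fin m → ℝ) : ℝ := 1 / (m : ℝ) * ∑ i, ν i

lemma natCast_mul_blockMean {m : ℕ} (ν : Fin m → ℝ) : m * blockMean ν = ∑ i, ν i := by
  rcases m.eq_zero_or_pos with rfl | hm
  · simp
  · rw [blockMean, ← mul_assoc, mul_one_div_cancel (mod_cast hm.ne'), one_mul]

lemma blockMean_mem_Icc {m : ℕ} {ν : Fin m → ℝ} (hν : ∀ i, ν i ∈ Set.Icc (0 : ℝ) 1) :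
    blockMean ν ∈ Set.Icc (0 : ℝ) 1 := by
  refine ⟨mul_nonneg (by positivity) (Finset.sum_nonneg fun i _ => (hν i).1), ?_⟩
  rw [blockMean, one_div_mul_eq_div]
  refine div_le_one_of_le₀ ?_ m.cast_nonneg
  simpa using Finset.sum_le_sum fun i (_ : i ∈ Finset.univ) => (hν i).2

lemma blockMean_const {m : ℕ} (hm : 0 < m) (c : ℝ) : blockMean (fun _ : Fin m => c) = c := by
  have : (m : ℝ) ≠ 0 := mod_cast hm.ne'
  simp [blockMean, this]

lemma blockMean_one_sub {m : ℕ} (hm : 0 < m) (ν : Fin m → ℝ) :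
    blockMean (fun i => 1 - ν i) = 1 - blockMean ν := by
  conv_rhs => rw [← blockMean_const hm 1]
  rw [blockMean, blockMean, blockMean, Finset.sum_sub_distrib, mul_sub]

lemma mgf_le_one_sub_add_mul_exp {α : Type*} [MeasurableSpace α] {μ : Measure α}
    [IsProbabilityMeasure μ] {h : α → ℝ} (hh : AEMeasurable h μ)
    (h01 : ∀ a, h a ∈ Set.Icc (0 : ℝ) 1) (t : ℝ) :
    mgf h μ t ≤ 1 - ∫ a, h a ∂μ + (∫ a, h a ∂μ) * Real.exp t := by
  have hint : Integrable h μ := .of_mem_Icc 0 1 hh (.of_forall h01)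
  have hint' : Integrable (fun a => 1 - h a) μ := (integrable_const 1).sub hint
  have hchord (a : α) : Real.exp (t * h a) ≤ 1 - h a + h a * Real.exp t := by
    simpa [mul_comm] using convexOn_exp.2 (Set.mem_univ 0) (Set.mem_univ t)
      (sub_nonneg.2 (h01 a).2) (h01 a).1 (sub_add_cancel 1 _)
  calc mgf h μ t ≤ ∫ a, (1 - h a + h a * Real.exp t) ∂μ :=
        integral_mono_of_nonneg (.of_forall fun _ => (Real.exp_pos _).le)
          (hint'.add (hint.mul_const _)) (.of_forall hchord)
    _ = 1 - ∫ a, h a ∂μ + (∫ a, h a ∂μ) * Real.exp t := by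
        rw [integral_add hint' (hint.mul_const _), integral_sub (integrable_const 1) hint,
          integral_mul_const, integral_const, probReal_univ, one_smul]

lemma mgf_sum_eval_pi {ι α : Type*} [Fintype ι] [MeasurableSpace α] (μ : Measure α)
    [IsProbabilityMeasure μ] {h : α → ℝ} (hh : Measurable h) (t : ℝ) :
    mgf (fun x : ι → α => ∑ i, h (x i)) (Measure.pi fun _ => μ) t = mgf h μ t ^ Fintype.card ι := by
  have hindep : iIndepFun (fun i (x : ι → α) => h (x i)) (Measure.pi fun _ => μ) :=
    iIndepFun_pi fun _ => hh.aemeasurable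
  have heval (i : ι) : mgf (fun x : ι → α => h (x i)) (Measure.pi fun _ => μ) t = mgf h μ t := by
    conv_rhs => rw [← (measurePreserving_eval (fun _ => μ) i).map_eq]
    exact (mgf_map (measurable_pi_apply i).aemeasurable (by fun_prop)).symm
  have hsum := hindep.mgf_sum (t := t) (fun i => hh.comp (measurable_pi_apply i)) Finset.univ
  simpa [heval, Finset.sum_fn] using hsum

/-- The optimal exponential tilt in the Chernoff bound is the difference of log-odds of `v`
and `q`. -/
lemma exp_log_odds_mul_eq_exp_neg_binaryKLReal {q v : ℝ} (hq : q ∈ Set.Ioo (0 : ℝ) 1)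
    (hv : v ∈ Set.Ioo (0 : ℝ) 1) :
    Real.exp (-(Real.log (v * (1 - q) / ((1 - v) * q)) * v)) *
      (1 - q + q * Real.exp (Real.log (v * (1 - q) / ((1 - v) * q)))) =
        Real.exp (-binaryKLReal v q) := by
  have hq0 := hq.1
  have hv0 := hv.1
  have hq1 := sub_pos.2 hq.2
  have hv1 := sub_pos.2 hv.2
  have hnorm : 1 - q + q * Real.exp (Real.log (v * (1 - q) / ((1 - v) * q))) =
      Real.exp (Real.log (1 - q) - Real.log (1 - v)) := by
    rw [Real.exp_log (by positivity), Real.exp_sub, Real.exp_log hq1, Real.exp_log hv1]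
    field_simp
    ring
  rw [hnorm, ← Real.exp_add, Real.log_div (by positivity) (by positivity),
    Real.log_mul hv0.ne' hq1.ne', Real.log_mul hv1.ne' hq0.ne', binaryKLReal, Real.binEntropy,
    Real.log_inv, Real.log_inv]
  congr 1
  ring

lemma measure_blockMean_le {α : Type*} [MeasurableSpace α] (μ : Measure α)
    [IsProbabilityMeasure μ] {h : α → ℝ} (hh : Measurable h)
    (h01 : ∀ a, h a ∈ Set.Icc (0 : ℝ) 1) {m : ℕ} {v : ℝ} (hv : 0 < v) (hvq : v ≤ ∫ a, h a ∂μ)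
    (hq : ∫ a, h a ∂μ < 1) :
    (Measure.pi fun _ : Fin m => μ).real {x | blockMean (fun i => h (x i)) ≤ v} ≤
      Real.exp (-(m * binaryKLReal v (∫ a, h a ∂μ))) := by
  set q := ∫ a, h a ∂μ
  have hqmem : q ∈ Set.Ioo (0 : ℝ) 1 := ⟨hv.trans_le hvq, hq⟩
  have hvmem : v ∈ Set.Ioo (0 : ℝ) 1 := ⟨hv, hvq.trans_lt hq⟩
  set t := Real.log (v * (1 - q) / ((1 - v) * q))
  have ht : t ≤ 0 := by
    have hden : 0 < (1 - v) * q := mul_pos (sub_pos.2 hvmem.2) hqmem.1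
    have hnum : 0 ≤ v * (1 - q) := mul_nonneg hv.le (sub_pos.2 hq).le
    exact Real.log_nonpos (div_nonneg hnum hden.le) ((div_le_one hden).2 (by linarith))
  have hsub : {x : Fin m → α | blockMean (fun i => h (x i)) ≤ v} ⊆ {x | ∑ i, h (x i) ≤ m * v} :=
    fun x hx => (natCast_mul_blockMean _).symm.trans_le (mul_le_mul_of_nonneg_left hx m.cast_nonneg)
  have hint : Integrable (fun x : Fin m → α => Real.exp (t * ∑ i, h (x i)))
      (Measure.pi fun _ => μ) := by
    have hmeas : Measurable fun x : Fin m → α => Real.exp (t * ∑ i, h (x i)) := by fun_prop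
    refine .of_mem_Icc 0 1 hmeas.aemeasurable (.of_forall fun x => ⟨(Real.exp_pos _).le, ?_⟩)
    exact Real.exp_le_one_iff.2
      (mul_nonpos_of_nonpos_of_nonneg ht (Finset.sum_nonneg fun i _ => (h01 (x i)).1))
  calc (Measure.pi fun _ : Fin m => μ).real {x | blockMean (fun i => h (x i)) ≤ v}
      ≤ (Measure.pi fun _ : Fin m => μ).real {x | ∑ i, h (x i) ≤ m * v} := measureReal_mono hsub
    _ ≤ Real.exp (-t * (m * v)) * mgf (fun x : Fin m → α => ∑ i, h (x i))
          (Measure.pi fun _ => μ) t := measure_le_le_exp_mul_mgf _ ht hint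
    _ = (Real.exp (-(t * v)) * mgf h μ t) ^ m := by
      rw [mgf_sum_eval_pi μ hh, Fintype.card_fin, mul_pow, ← Real.exp_nat_mul]
      congr 2
      ring
    _ ≤ (Real.exp (-(t * v)) * (1 - q + q * Real.exp t)) ^ m := by
      gcongr
      · exact mul_nonneg (Real.exp_pos _).le mgf_nonneg
      · exact mgf_le_one_sub_add_mul_exp hh.aemeasurable h01 t
    _ = Real.exp (-(m * binaryKLReal v q)) := by
      rw [exp_log_odds_mul_eq_exp_neg_binaryKLReal hqmem hvmem, ← Real.exp_nat_mul, mul_neg]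

/-- The blocks on which the mean of `h` falls below `q` by more than `ε` in binary relative
entropy. -/
def klLowerTail {α : Type*} {m : ℕ} (h : α → ℝ) (q ε : ℝ) : Set (Fin m → α) :=
  {x | blockMean (fun i => h (x i)) < q ∧
    (ε : EReal) < binaryKL (blockMean fun i => h (x i)) q}

/-- The blocks on which the mean of `h` exceeds `q` by more than `ε` in binary relative entropy. -/
def klUpperTail {α : Type*} {m : ℕ} (h : α → ℝ) (q ε : ℝ) : Set (Fin m → α) :=
  {x | q < blockMean (fun i => h (x i)) ∧
    (ε : EReal) < binaryKL (blockMean fun i => h (x i)) q}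

lemma ae_blockMean_eq_one {α : Type*} [MeasurableSpace α] {μ : Measure α}
    [IsProbabilityMeasure μ] {h : α → ℝ} (hh : Measurable h)
    (h01 : ∀ a, h a ∈ Set.Icc (0 : ℝ) 1) (hq : ∫ a, h a ∂μ = 1) {m : ℕ} (hm : 0 < m) :
    ∀ᵐ x ∂(Measure.pi fun _ : Fin m => μ), blockMean (fun i => h (x i)) = 1 := by
  have hint : Integrable h μ := .of_mem_Icc 0 1 hh.aemeasurable (.of_forall h01)
  have hone : h =ᵐ[μ] fun _ => 1 :=
    (integral_eq_iff_of_ae_le hint (integrable_const 1) (.of_forall fun a => (h01 a).2)).1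
      (by rw [hq, integral_const, probReal_univ, one_smul])
  have hone_pi (i : Fin m) : ∀ᵐ x ∂(Measure.pi fun _ : Fin m => μ), h (x i) = 1 :=
    (measurePreserving_eval (fun _ => μ) i).quasiMeasurePreserving.ae hone
  filter_upwards [ae_all_iff.2 hone_pi] with x hx
  simp only [hx, blockMean_const hm]

lemma measure_klLowerTail_le {α : Type*} [MeasurableSpace α] (μ : Measure α)
    [IsProbabilityMeasure μ] {h : α → ℝ} (hh : Measurable h)
    (h01 : ∀ a, h a ∈ Set.Icc (0 : ℝ) 1) {m : ℕ} (hm : 0 < m) {ε : ℝ} (hε : 0 ≤ ε) :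
    (Measure.pi fun _ : Fin m => μ).real (klLowerTail h (∫ a, h a ∂μ) ε) ≤
      Real.exp (-(m * ε)) := by
  have hqmem : ∫ a, h a ∂μ ∈ Set.Icc (0 : ℝ) 1 := (convex_Icc 0 1).integral_mem isClosed_Icc
    (.of_forall h01) (.of_mem_Icc 0 1 hh.aemeasurable (.of_forall h01))
  rcases hqmem.2.eq_or_lt with hq1 | hq1
  · have hnull : (Measure.pi fun _ : Fin m => μ) (klLowerTail h (∫ a, h a ∂μ) ε) = 0 := by
      refine measure_mono_null (fun x hx => ?_) (ae_blockMean_eq_one hh h01 hq1 hm)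
      exact (hx.1.trans_eq hq1).ne
    rw [measureReal_def, hnull]
    exact (Real.exp_pos _).le
  set q := ∫ a, h a ∂μ
  rcases (klLowerTail h q ε : Set (Fin m → α)).eq_empty_or_nonempty with hempty | ⟨y, hy⟩
  · rw [hempty, measureReal_empty]
    exact (Real.exp_pos _).le
  have hmean (x : Fin m → α) : 0 ≤ blockMean fun i => h (x i) :=
    (blockMean_mem_Icc fun i => h01 (x i)).1
  have hq0 : 0 < q := (hmean y).trans_lt hy.1
  have hkl (p : ℝ) : binaryKL p q = binaryKLReal p q := binaryKL_eq_coe_binaryKLReal ⟨hq0, hq1⟩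
  have hanti := antitoneOn_binaryKLReal_left hq1
  have hε0 : ε < binaryKLReal 0 q :=
    (EReal.coe_lt_coe_iff.1 (hy.2.trans_eq (hkl _))).trans_le
      (hanti ⟨le_rfl, hq0.le⟩ ⟨hmean y, hy.1.le⟩ (hmean y))
  obtain ⟨v, hv, rfl⟩ : ε ∈ (fun p => binaryKLReal p q) '' Set.Icc 0 q :=
    intermediate_value_Icc' hq0.le (continuous_binaryKLReal_left q).continuousOn
      ⟨(binaryKLReal_self q).trans_le hε, hε0.le⟩
  have hv0 : 0 < v := hv.1.lt_of_ne fun h0 => hε0.ne (by rw [← h0])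
  refine (measureReal_mono fun x hx => ?_).trans (measure_blockMean_le μ hh h01 hv0 hv.2 hq1)
  by_contra! hlt
  exact (hx.2.trans_eq (hkl _)).not_ge
    (EReal.coe_le_coe_iff.2 (hanti hv ⟨hmean x, hx.1.le⟩ (le_of_not_ge hlt)))

lemma measure_klUpperTail_le {α : Type*} [MeasurableSpace α] (μ : Measure α)
    [IsProbabilityMeasure μ] {h : α → ℝ} (hh : Measurable h)
    (h01 : ∀ a, h a ∈ Set.Icc (0 : ℝ) 1) {m : ℕ} (hm : 0 < m) {ε : ℝ} (hε : 0 ≤ ε) :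
    (Measure.pi fun _ : Fin m => μ).real (klUpperTail h (∫ a, h a ∂μ) ε) ≤
      Real.exp (-(m * ε)) := by
  have hcompl : ∫ a, (1 - h a) ∂μ = 1 - ∫ a, h a ∂μ := by
    rw [integral_sub (integrable_const 1) (.of_mem_Icc 0 1 hh.aemeasurable (.of_forall h01)),
      integral_const, probReal_univ, one_smul]
  refine (measureReal_mono fun x hx => ?_).trans (measure_klLowerTail_le μ (hh.const_sub 1)
    (fun a => Set.Icc.mem_iff_one_sub_mem.1 (h01 a)) hm hε)
  rw [klLowerTail, hcompl]
  simp only [blockMean_one_sub hm, binaryKL_one_sub_one_sub]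
  exact ⟨sub_lt_sub_left hx.1 1, hx.2⟩

/-! ### The outputs of the procedure -/

/-- The radius `ln (K / (2δ)) / m` of `klBall δ K m`. -/
noncomputable def klRadius (δ : ℝ) (K m : ℕ) : ℝ := Real.log ((K : ℝ) / (2 * δ)) / m

lemma klRadius_nonneg {δ : ℝ} (hδ : 0 < δ) {K : ℕ} (hK : 2 * δ ≤ K) (m : ℕ) :
    0 ≤ klRadius δ K m :=
  div_nonneg (Real.log_nonneg ((one_le_div (by positivity)).2 hK)) m.cast_nonneg

lemma exp_neg_mul_klRadius {δ : ℝ} (hδ : 0 < δ) {K m : ℕ} (hK : 0 < K) (hm : 0 < m) :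
    Real.exp (-(m * klRadius δ K m)) = 2 * δ / K := by
  have hm' : (m : ℝ) ≠ 0 := mod_cast hm.ne'
  have hK' : (0 : ℝ) < K := mod_cast hK
  rw [klRadius, mul_div_cancel₀ _ hm', Real.exp_neg, Real.exp_log (div_pos hK' (by positivity)),
    inv_div]

lemma le_sSup_klBall {δ : ℝ} {K m : ℕ} (hr : 0 ≤ klRadius δ K m) {V v q : ℝ} (hV : 0 ≤ V)
    (hVv : V ≤ v) (hv : v ≤ 1) (hq : q ≤ 1) (h : V < q → binaryKL V q ≤ klRadius δ K m) :
    q ≤ sSup (klBall δ K m v) := by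
  have hbdd : BddAbove (klBall δ K m v) := ⟨1, fun u hu => hu.1.2⟩
  rcases le_or_gt q v with hqv | hvq
  · have hself : binaryKL v v ≤ klRadius δ K m := (binaryKL_self v).trans_le (mod_cast hr)
    exact hqv.trans (le_csSup hbdd ⟨⟨hV.trans hVv, hv⟩, hself⟩)
  · have hanti : binaryKL v q ≤ binaryKL V q :=
      antitoneOn_binaryKL_left hq ⟨hV, (hVv.trans_lt hvq).le⟩ ⟨hV.trans hVv, hvq.le⟩ hVv
    exact le_csSup hbdd
      ⟨⟨(hV.trans hVv).trans hvq.le, hq⟩, hanti.trans (h (hVv.trans_lt hvq))⟩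

lemma sInf_klBall_le {δ : ℝ} {K m : ℕ} (hr : 0 ≤ klRadius δ K m) {V v q : ℝ} (hV : V ≤ 1)
    (hvV : v ≤ V) (hv : 0 ≤ v) (hq : 0 ≤ q) (h : q < V → binaryKL V q ≤ klRadius δ K m) :
    sInf (klBall δ K m v) ≤ q := by
  have hbdd : BddBelow (klBall δ K m v) := ⟨0, fun u hu => hu.1.1⟩
  rcases le_or_gt v q with hvq | hqv
  · have hself : binaryKL v v ≤ klRadius δ K m := (binaryKL_self v).trans_le (mod_cast hr)
    exact (csInf_le hbdd ⟨⟨hv, hvV.trans hV⟩, hself⟩).trans hvq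
  · have hanti : binaryKL v q ≤ binaryKL V q := by
      rw [← binaryKL_one_sub_one_sub v, ← binaryKL_one_sub_one_sub V]
      exact antitoneOn_binaryKL_left (sub_le_self 1 hq) ⟨by linarith, by linarith⟩
        ⟨by linarith, by linarith⟩ (sub_le_sub_left hvV 1)
    exact csInf_le hbdd
      ⟨⟨hq, hqv.le.trans (hvV.trans hV)⟩, hanti.trans (h (hqv.trans_le hvV))⟩

section Outputs

variable {Θ 𝒳 : Type*} [MeasurableSpace Θ] {f : Θ → 𝒳 → ℝ} {Q P₀ : Measure Θ} {δ : ℝ} {n K m : ℕ}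
  {x : Fin n → 𝒳}

lemma blockValues_subset_Icc {θ : Fin m → Θ} : blockValues f Q P₀ δ x θ ⊆ Set.Icc 0 1 := by
  rintro _ ⟨ν, hν, rfl⟩
  exact blockMean_mem_Icc hν.1

lemma le_iSup_sSup_blockValues {θ : Fin K → Fin m → Θ} {k : Fin K} {ν : Fin m → ℝ}
    (hν : ν ∈ feasible f Q P₀ δ x (θ k)) :
    blockMean ν ≤ ⨆ k, sSup (blockValues f Q P₀ δ x (θ k)) :=
  (le_csSup ⟨1, fun _ hu => (blockValues_subset_Icc hu).2⟩ (Set.mem_image_of_mem _ hν)).trans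
    (le_ciSup (f := fun j => sSup (blockValues f Q P₀ δ x (θ j))) (Set.finite_range _).bddAbove k)

lemma iInf_sInf_blockValues_le {θ : Fin K → Fin m → Θ} {k : Fin K} {ν : Fin m → ℝ}
    (hν : ν ∈ feasible f Q P₀ δ x (θ k)) :
    ⨅ k, sInf (blockValues f Q P₀ δ x (θ k)) ≤ blockMean ν :=
  (ciInf_le (f := fun j => sInf (blockValues f Q P₀ δ x (θ j))) (Set.finite_range _).bddBelow
    k).trans
    (csInf_le ⟨0, fun _ hu => (blockValues_subset_Icc hu).1⟩ (Set.mem_image_of_mem _ hν))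

lemma le_upperOutput {θ : Fin K → Fin m → Θ} (hr : 0 ≤ klRadius δ K m) {h : Θ → ℝ} {q : ℝ}
    (hq : q ≤ 1) {k : Fin K} (hfeas : (fun i => h (θ k i)) ∈ feasible f Q P₀ δ x (θ k))
    (htail : θ k ∉ klLowerTail h q (klRadius δ K m)) : q ≤ upperOutput f Q P₀ δ x θ := by
  refine le_sSup_klBall hr (blockMean_mem_Icc hfeas.1).1 (le_iSup_sSup_blockValues hfeas) ?_ hq
    fun hlt => not_lt.1 fun hkl => htail ⟨hlt, hkl⟩
  exact Real.iSup_le (fun _ => Real.sSup_le (fun _ hu => (blockValues_subset_Icc hu).2) zero_le_one)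
    zero_le_one

lemma lowerOutput_le {θ : Fin K → Fin m → Θ} (hr : 0 ≤ klRadius δ K m) {h : Θ → ℝ} {q : ℝ}
    (hq : 0 ≤ q) {k : Fin K} (hfeas : (fun i => h (θ k i)) ∈ feasible f Q P₀ δ x (θ k))
    (htail : θ k ∉ klUpperTail h q (klRadius δ K m)) : lowerOutput f Q P₀ δ x θ ≤ q := by
  refine sInf_klBall_le hr (blockMean_mem_Icc hfeas.1).2 (iInf_sInf_blockValues_le hfeas) ?_ hq
    fun hlt => not_lt.1 fun hkl => htail ⟨hlt, hkl⟩
  exact Real.iInf_nonneg fun _ => Real.sInf_nonneg fun _ hu => (blockValues_subset_Icc hu).1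

end Outputs

/-! ### Failure of all blocks -/

/-- The blocks on which the sum of `Z` exceeds `e m b`. For `Z` an upper bound on the optimal
log-wealth and `b` a lower bound on the budget of `feasible`, every other block is feasible. -/
def overBudget {α : Type*} {m : ℕ} (Z : α → ENNReal) (b : ENNReal) : Set (Fin m → α) :=
  {x | ENNReal.ofReal (Real.exp 1 * m) * b < ∑ i, Z (x i)}

lemma lintegral_sum_eval_pi {ι α : Type*} [Fintype ι] [MeasurableSpace α] (μ : Measure α)
    [IsProbabilityMeasure μ] {Z : α → ENNReal} (hZ : Measurable Z) :
    ∫⁻ x : ι → α, ∑ i, Z (x i) ∂(Measure.pi fun _ => μ) = Fintype.card ι * ∫⁻ a, Z a ∂μ := by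
  have heval (i : ι) : ∫⁻ x : ι → α, Z (x i) ∂(Measure.pi fun _ => μ) = ∫⁻ a, Z a ∂μ :=
    (measurePreserving_eval (fun _ => μ) i).lintegral_comp hZ
  rw [lintegral_finsetSum _ fun i _ => by fun_prop]
  simp only [heval, Finset.sum_const, Finset.card_univ, nsmul_eq_mul]

lemma measure_overBudget_le {α : Type*} [MeasurableSpace α] (μ : Measure α)
    [IsProbabilityMeasure μ] {Z : α → ENNReal} (hZ : Measurable Z) {m : ℕ} (hm : 0 < m)
    {b : ENNReal} {L τ : ℝ} (hL : 0 < L) (hLb : ENNReal.ofReal L ≤ b) (hτ : 0 ≤ τ)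
    (hb : ∫⁻ a, Z a ∂μ ≤ b + ENNReal.ofReal τ) :
    (Measure.pi fun _ : Fin m => μ).real (overBudget Z b) ≤ Real.exp (-1) * (1 + τ / L) := by
  have hm' : (0 : ℝ) < m := mod_cast hm
  refine ENNReal.toReal_le_of_le_ofReal (by positivity) ?_
  rcases eq_or_ne b ⊤ with rfl | hb_top
  · have hempty : (overBudget Z ⊤ : Set (Fin m → α)) = ∅ := by
      have hthreshold : ENNReal.ofReal (Real.exp 1 * m) * ⊤ = ⊤ :=
        ENNReal.mul_top (ENNReal.ofReal_pos.2 (by positivity)).ne'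
      simp only [overBudget, hthreshold, not_top_lt, Set.ofPred_false]
    rw [hempty, measure_empty]
    exact zero_le
  obtain ⟨r, rfl⟩ : ∃ r : ℝ, b = ENNReal.ofReal r := ⟨_, (ENNReal.ofReal_toReal hb_top).symm⟩
  have hLr : L ≤ r := (ENNReal.ofReal_le_ofReal_iff' .. ).1 hLb |>.resolve_right hL.not_ge
  have hr : 0 < r := hL.trans_le hLr
  have hbudget : 0 < Real.exp 1 * m * r := by positivity
  have hmeas : Measurable fun x : Fin m → α => ∑ i, Z (x i) := by fun_prop
  have hsub : (overBudget Z (ENNReal.ofReal r) : Set (Fin m → α)) ⊆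
      {x | ENNReal.ofReal (Real.exp 1 * m * r) ≤ ∑ i, Z (x i)} := fun x hx =>
    (ENNReal.ofReal_mul (by positivity)).trans_le (le_of_lt hx)
  calc (Measure.pi fun _ : Fin m => μ) (overBudget Z (ENNReal.ofReal r))
      ≤ (∫⁻ x : Fin m → α, ∑ i, Z (x i) ∂(Measure.pi fun _ => μ)) /
          ENNReal.ofReal (Real.exp 1 * m * r) :=
        (measure_mono hsub).trans (meas_ge_le_lintegral_div hmeas.aemeasurable
          (ENNReal.ofReal_pos.2 hbudget).ne' ENNReal.ofReal_ne_top)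
    _ ≤ ENNReal.ofReal (m * (r + τ)) / ENNReal.ofReal (Real.exp 1 * m * r) := by
        rw [lintegral_sum_eval_pi μ hZ, Fintype.card_fin, ENNReal.ofReal_mul hm'.le,
          ENNReal.ofReal_natCast, ENNReal.ofReal_add hr.le hτ]
        gcongr
    _ = ENNReal.ofReal (Real.exp (-1) * (1 + τ / r)) := by
        rw [← ENNReal.ofReal_div_of_pos hbudget, Real.exp_neg]
        congr 1
        field_simp
    _ ≤ ENNReal.ofReal (Real.exp (-1) * (1 + τ / L)) := by gcongr

lemma add_pow_sub_pow_le_add_pow_sub_pow {a p s : ℝ} (ha : 0 ≤ a) (hap : a ≤ p) (hs : 0 ≤ s)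
    (K : ℕ) : (a + s) ^ K - a ^ K ≤ (p + s) ^ K - p ^ K := by
  rw [← geom_sum₂_mul, ← geom_sum₂_mul, add_sub_cancel_left, add_sub_cancel_left]
  have hps : 0 ≤ p + s := add_nonneg (ha.trans hap) hs
  gcongr

lemma measureReal_pi_forall_mem {ι α : Type*} [Fintype ι] [MeasurableSpace α] (ρ : Measure α)
    [SigmaFinite ρ] (A : Set α) :
    (Measure.pi fun _ : ι => ρ).real {x | ∀ i, x i ∈ A} = ρ.real A ^ Fintype.card ι := by
  have hpi : {x : ι → α | ∀ i, x i ∈ A} = Set.univ.pi fun _ => A := by ext; simp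
  rw [hpi, measureReal_def, Measure.pi_pi, Finset.prod_const, Finset.card_univ, ENNReal.toReal_pow,
    measureReal_def]

/-- Adding the probabilities of the two events would count the common part `∀ i, x i ∈ b` twice;
subtracting it once keeps the leading term `p ^ K` single. -/
lemma measureReal_pi_forall_mem_union_le {ι α : Type*} [Fintype ι] [MeasurableSpace α]
    (ρ : Measure α) [IsProbabilityMeasure ρ] {b l u : Set α} (hb : MeasurableSet b) {p s : ℝ}
    (hbp : ρ.real b ≤ p) (hls : ρ.real l ≤ s) (hus : ρ.real u ≤ s) :
    (Measure.pi fun _ : ι => ρ).real ({x | ∀ i, x i ∈ b ∪ l} ∪ {x | ∀ i, x i ∈ b ∪ u}) ≤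
      2 * (p + s) ^ Fintype.card ι - p ^ Fintype.card ι := by
  have hb0 : 0 ≤ ρ.real b := measureReal_nonneg
  have hs0 : 0 ≤ s := measureReal_nonneg.trans hls
  have hbmeas : MeasurableSet {x : ι → α | ∀ i, x i ∈ b} := by measurability
  have hsub : ({x | ∀ i, x i ∈ b ∪ l} ∪ {x | ∀ i, x i ∈ b ∪ u} : Set (ι → α)) ⊆
      {x | ∀ i, x i ∈ b ∪ l} ∪ ({x | ∀ i, x i ∈ b ∪ u} \ {x | ∀ i, x i ∈ b}) := by
    rintro x (hx | hx)
    · exact Or.inl hx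
    · by_cases hall : ∀ i, x i ∈ b
      · exact Or.inl fun i => Or.inl (hall i)
      · exact Or.inr ⟨hx, hall⟩
  have hbu : {x : ι → α | ∀ i, x i ∈ b} ⊆ {x | ∀ i, x i ∈ b ∪ u} := fun x hx i => Or.inl (hx i)
  have hunion {c : Set α} (hc : ρ.real c ≤ s) : ρ.real (b ∪ c) ≤ ρ.real b + s :=
    (measureReal_union_le b c).trans (by gcongr)
  calc (Measure.pi fun _ : ι => ρ).real ({x | ∀ i, x i ∈ b ∪ l} ∪ {x | ∀ i, x i ∈ b ∪ u})
      ≤ ρ.real (b ∪ l) ^ Fintype.card ι +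
          (ρ.real (b ∪ u) ^ Fintype.card ι - ρ.real b ^ Fintype.card ι) := by
        refine (measureReal_mono hsub).trans ((measureReal_union_le _ _).trans_eq ?_)
        rw [measureReal_sdiff hbu hbmeas]
        simp only [measureReal_pi_forall_mem]
    _ ≤ (p + s) ^ Fintype.card ι +
          ((ρ.real b + s) ^ Fintype.card ι - ρ.real b ^ Fintype.card ι) := by
        gcongr
        · exact (hunion hls).trans (by gcongr)
        · exact hunion hus
    _ ≤ 2 * (p + s) ^ Fintype.card ι - p ^ Fintype.card ι := by
        linarith [add_pow_sub_pow_le_add_pow_sub_pow hb0 hbp hs0 (Fintype.card ι)]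

/-! ### An affine majorant of the failure probability -/

lemma posLog_le_exp_neg_one_mul {z : ℝ} (hz : 0 ≤ z) : Real.posLog z ≤ Real.exp (-1) * z := by
  refine max_le (by positivity) ?_
  rcases hz.eq_or_lt with rfl | hz
  · simp
  have hlog := Real.log_le_sub_one_of_pos (mul_pos (Real.exp_pos (-1)) hz)
  rw [Real.log_mul (Real.exp_pos _).ne' hz.ne', Real.log_exp] at hlog
  linarith

lemma posLog_sq_le {z : ℝ} (hz : 0 ≤ z) :
    Real.posLog z ^ 2 ≤ 4 * Real.exp (-1) ^ 2 * z := by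
  calc Real.posLog z ^ 2 = (2 * Real.posLog √z) ^ 2 := by
        rw [show 2 * Real.posLog √z = Real.posLog (√z ^ 2) from (Real.posLog_pow 2 √z).symm,
          Real.sq_sqrt hz]
    _ ≤ (2 * (Real.exp (-1) * √z)) ^ 2 := by
        have hroot := posLog_le_exp_neg_one_mul (Real.sqrt_nonneg z)
        have := Real.posLog_nonneg (x := √z)
        gcongr
    _ = 4 * Real.exp (-1) ^ 2 * z := by
        rw [mul_pow, mul_pow, Real.sq_sqrt hz]
        ring

/-- The Markov bound on the probability that a block is over budget, when the wealth averaged over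
the prior is `w`. -/
noncomputable def overBudgetBound (δ w : ℝ) : ℝ :=
  Real.exp (-1) * (1 + Real.posLog (δ * w) / Real.log (1 / δ))

lemma overBudgetBound_of_mul_le_one {δ w : ℝ} (h0 : 0 ≤ δ * w) (h1 : δ * w ≤ 1) :
    overBudgetBound δ w = Real.exp (-1) := by
  rw [overBudgetBound, (Real.posLog_eq_zero_iff _).2 ((abs_of_nonneg h0).trans_le h1), zero_div,
    add_zero, mul_one]

lemma overBudgetBound_le {δ : ℝ} (hL : 1 ≤ Real.log (1 / δ)) (w : ℝ) :
    overBudgetBound δ w ≤ Real.exp (-1) * (1 + Real.posLog (δ * w)) := by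
  rw [overBudgetBound]
  gcongr
  exact div_le_self Real.posLog_nonneg hL

lemma overBudgetBound_nonneg {δ : ℝ} (hL : 0 ≤ Real.log (1 / δ)) (w : ℝ) :
    0 ≤ overBudgetBound δ w :=
  mul_nonneg (Real.exp_pos _).le (add_nonneg zero_le_one (div_nonneg Real.posLog_nonneg hL))

lemma two_mul_sq_sub_sq_overBudgetBound_le {δ w : ℝ} (hδ : 0 ≤ δ) (hL : 1 ≤ Real.log (1 / δ))
    (hw : 0 ≤ w) :
    2 * (overBudgetBound δ w + δ) ^ 2 - overBudgetBound δ w ^ 2 ≤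
      Real.exp (-1) ^ 2 + 4 * δ * Real.exp (-1) + 2 * δ ^ 2 +
        δ * (2 * Real.exp (-1) ^ 3 + 4 * Real.exp (-1) ^ 4 + 4 * δ * Real.exp (-1) ^ 2) * w := by
  have hz : 0 ≤ δ * w := mul_nonneg hδ hw
  have hp := overBudgetBound_le hL w
  have hp0 := overBudgetBound_nonneg (zero_le_one.trans hL) w
  have hlog := posLog_le_exp_neg_one_mul hz
  have hlog_sq := posLog_sq_le hz
  have hlog0 := Real.posLog_nonneg (x := δ * w)
  set p := overBudgetBound δ w
  set x := Real.exp (-1)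
  set τ := Real.posLog (δ * w)
  calc 2 * (p + δ) ^ 2 - p ^ 2 = p ^ 2 + 4 * δ * p + 2 * δ ^ 2 := by ring
    _ ≤ (x * (1 + τ)) ^ 2 + 4 * δ * (x * (1 + τ)) + 2 * δ ^ 2 := by gcongr
    _ = x ^ 2 + 4 * δ * x + 2 * δ ^ 2 + (2 * x ^ 2 * τ + x ^ 2 * τ ^ 2 + 4 * δ * x * τ) := by ring
    _ ≤ x ^ 2 + 4 * δ * x + 2 * δ ^ 2 + (2 * x ^ 2 * (x * (δ * w)) +
          x ^ 2 * (4 * x ^ 2 * (δ * w)) + 4 * δ * x * (x * (δ * w))) := by gcongr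
    _ = x ^ 2 + 4 * δ * x + 2 * δ ^ 2 + δ * (2 * x ^ 3 + 4 * x ^ 4 + 4 * δ * x ^ 2) * w := by ring

lemma quadratic_coeff_le {δ : ℝ} (hδ : Real.exp (-1) ^ 2 ≤ δ) (hδ3 : δ ≤ 1 / 3) :
    Real.exp (-1) ^ 2 + 4 * δ * Real.exp (-1) + 2 * δ ^ 2 +
      δ * (2 * Real.exp (-1) ^ 3 + 4 * Real.exp (-1) ^ 4 + 4 * δ * Real.exp (-1) ^ 2) ≤ 3 * δ := by
  have hupper : Real.exp (-1) ≤ 0.36788 := Real.exp_neg_one_lt_d9.le.trans (by norm_num)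
  have hlower : 0.1353 ≤ δ :=
    calc (0.1353 : ℝ) ≤ 0.36787 ^ 2 := by norm_num
      _ ≤ Real.exp (-1) ^ 2 := by
        gcongr
        exact le_trans (by norm_num) Real.exp_neg_one_gt_d9.le
      _ ≤ δ := hδ
  have hconvex := mul_nonneg (sub_nonneg.2 hlower) (sub_nonneg.2 hδ3)
  have : 0 ≤ δ := by linarith
  calc _ ≤ 0.36788 ^ 2 + 4 * δ * 0.36788 + 2 * δ ^ 2 +
        δ * (2 * 0.36788 ^ 3 + 4 * 0.36788 ^ 4 + 4 * δ * 0.36788 ^ 2) := by gcongr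
    _ ≤ 3 * δ := by linarith

lemma add_div_pow_le_pow_mul_exp {x y : ℝ} (hx : 0 ≤ x) (hy : 0 ≤ y) {K : ℕ} (hK : K ≠ 0) :
    (x + x * y / K) ^ K ≤ x ^ K * Real.exp y := by
  calc (x + x * y / K) ^ K = x ^ K * (y / K + 1) ^ K := by
        rw [← mul_pow]
        ring
    _ ≤ x ^ K * Real.exp (y / K) ^ K := by
        gcongr
        exact Real.add_one_le_exp _
    _ = x ^ K * Real.exp y := by
        rw [← Real.exp_nat_mul, mul_div_cancel₀ _ (mod_cast hK)]

lemma two_mul_pow_sub_pow_le {δ : ℝ} (hδ : 0 ≤ δ) {K : ℕ} (hK : 3 ≤ K)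
    (hKδ : Real.exp (-1) ^ K ≤ δ) (hδ2 : δ ≤ Real.exp (-1) ^ 2) :
    2 * (Real.exp (-1) + 2 * δ / K) ^ K - Real.exp (-1) ^ K ≤ 2 * δ := by
  have hx0 := Real.exp_pos (-1)
  have hx1 : Real.exp (-1) ≤ 0.36788 := Real.exp_neg_one_lt_d9.le.trans (by norm_num)
  set x := Real.exp (-1)
  obtain ⟨y, hxy⟩ : ∃ y, x * y = 2 * δ := ⟨2 * δ / x, mul_div_cancel₀ _ hx0.ne'⟩
  have hy0 : 0 ≤ y := nonneg_of_mul_nonneg_right (hxy.symm ▸ by positivity) hx0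
  have hy2 : y ≤ 2 * x := le_of_mul_le_mul_left (by linarith) hx0
  have hexp : Real.exp y ≤ 1 + y + y ^ 2 := by
    have hquad := Real.abs_exp_sub_one_sub_id_le (x := y) (by rw [abs_of_nonneg hy0]; linarith)
    linarith [(abs_le.1 hquad).2]
  have hpow : (x + 2 * δ / K) ^ K ≤ x ^ K * (1 + y + y ^ 2) := by
    rw [← hxy]
    exact (add_div_pow_le_pow_mul_exp hx0.le hy0 (by lia)).trans (by gcongr)
  have hrest : 2 * (x ^ K * (y + y ^ 2)) ≤ δ := by
    have hxK : x ^ K ≤ x ^ 3 := pow_le_pow_of_le_one hx0.le (by linarith) hK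
    calc 2 * (x ^ K * (y + y ^ 2)) ≤ 2 * (x ^ 3 * (y + y ^ 2)) := by
          have := mul_le_mul_of_nonneg_right hxK (add_nonneg hy0 (sq_nonneg y))
          linarith
      _ = 4 * x ^ 2 * (1 + y) * δ := by linear_combination 2 * x ^ 2 * (1 + y) * hxy
      _ ≤ 4 * 0.36788 ^ 2 * (1 + 2 * 0.36788) * δ := by
          gcongr
          linarith
      _ ≤ δ := by linarith
  linarith

lemma one_lt_log_one_div {δ : ℝ} (hδ0 : 0 < δ) (hδ3 : δ < 1 / 3) : 1 < Real.log (1 / δ) := by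
  rw [Real.lt_log_iff_exp_lt (by positivity)]
  calc Real.exp 1 < 3 := Real.exp_one_lt_three
    _ < 1 / δ := by rwa [lt_one_div three_pos hδ0]

lemma two_le_ceil_log_one_div {δ : ℝ} (hδ0 : 0 < δ) (hδ3 : δ < 1 / 3) :
    2 ≤ ⌈Real.log (1 / δ)⌉₊ :=
  Nat.lt_ceil.2 (mod_cast one_lt_log_one_div hδ0 hδ3)

lemma exp_neg_one_pow_ceil_log_le {δ : ℝ} (hδ : 0 < δ) :
    Real.exp (-1) ^ ⌈Real.log (1 / δ)⌉₊ ≤ δ := by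
  rw [← Real.exp_nat_mul, ← Real.le_log_iff_exp_le hδ]
  have := Nat.le_ceil (Real.log (1 / δ))
  rw [one_div, Real.log_inv] at *
  linarith

lemma le_exp_neg_one_pow_of_lt_ceil_log {δ : ℝ} (hδ : 0 < δ) {j : ℕ}
    (hj : j < ⌈Real.log (1 / δ)⌉₊) : δ ≤ Real.exp (-1) ^ j := by
  rw [← Real.exp_nat_mul, ← Real.log_le_iff_le_exp hδ]
  have := Nat.lt_ceil.1 hj
  rw [one_div, Real.log_inv] at this
  linarith

lemma exists_affine_majorant {δ : ℝ} (hδ0 : 0 < δ) (hδ3 : δ < 1 / 3) {K : ℕ}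
    (hK : K = ⌈Real.log (1 / δ)⌉₊) :
    ∃ c₀ c₁ : ℝ, 0 ≤ c₀ ∧ 0 ≤ c₁ ∧ c₀ + c₁ ≤ 3 * δ ∧ ∀ w, 0 ≤ w →
      min 1 (2 * (overBudgetBound δ w + 2 * δ / K) ^ K - overBudgetBound δ w ^ K) ≤
        c₀ + c₁ * w := by
  have hKδ : Real.exp (-1) ^ K ≤ δ := hK ▸ exp_neg_one_pow_ceil_log_le hδ0
  have hK2 : 2 ≤ K := hK ▸ two_le_ceil_log_one_div hδ0 hδ3
  rcases hK2.eq_or_lt with rfl | hK3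
  · refine ⟨_, _, by positivity, by positivity, quadratic_coeff_le hKδ hδ3.le, fun w hw => ?_⟩
    rw [Nat.cast_ofNat, mul_div_cancel_left₀ δ two_ne_zero]
    exact (min_le_right _ _).trans
      (two_mul_sq_sub_sq_overBudgetBound_le hδ0.le (one_lt_log_one_div hδ0 hδ3).le hw)
  · refine ⟨2 * δ, δ, by positivity, by positivity, by linarith, fun w hw => ?_⟩
    have hw0 : 0 ≤ δ * w := by positivity
    rcases le_or_gt (δ * w) 1 with hw1 | hw1
    · have hδ2 : δ ≤ Real.exp (-1) ^ 2 := le_exp_neg_one_pow_of_lt_ceil_log hδ0 (hK ▸ hK3)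
      rw [overBudgetBound_of_mul_le_one hw0 hw1]
      exact (min_le_right _ _).trans
        ((two_mul_pow_sub_pow_le hδ0.le hK3 hKδ hδ2).trans (by linarith))
    · exact (min_le_left _ _).trans (by linarith)

/-! ### The failure set -/

section FailureSet

variable {α β : Type*} [MeasurableSpace α] [MeasurableSpace β]

lemma measurableSet_overBudget_prod {m : ℕ} {Z : β → α → ENNReal}
    (hZ : Measurable (Function.uncurry Z)) {b : β → ENNReal} (hb : Measurable b) :
    MeasurableSet {p : β × (Fin m → α) | p.2 ∈ overBudget (Z p.1) (b p.1)} := by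
  have hZi (i : Fin m) : Measurable fun p : β × (Fin m → α) => Z p.1 (p.2 i) :=
    hZ.comp (by fun_prop : Measurable fun p : β × (Fin m → α) => (p.1, p.2 i))
  exact measurableSet_lt ((hb.comp measurable_fst).const_mul _)
    (Finset.measurable_fun_sum _ fun i _ => hZi i)

lemma measurable_blockMean_comp {m : ℕ} {h : α → ℝ} (hh : Measurable h) :
    Measurable fun x : Fin m → α => blockMean fun i => h (x i) := by
  unfold blockMean
  fun_prop

lemma measurableSet_klLowerTail_prod {m : ℕ} {h : α → ℝ} (hh : Measurable h) {q : β → ℝ}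
    (hq : Measurable q) (ε : ℝ) :
    MeasurableSet {p : β × (Fin m → α) | p.2 ∈ klLowerTail h (q p.1) ε} := by
  have hmean : Measurable fun p : β × (Fin m → α) => blockMean fun i => h (p.2 i) :=
    (measurable_blockMean_comp hh).comp measurable_snd
  have hq' : Measurable fun p : β × (Fin m → α) => q p.1 := hq.comp measurable_fst
  exact (measurableSet_lt hmean hq').inter
    (measurableSet_lt measurable_const (measurable_binaryKL hmean hq'))

lemma measurableSet_klUpperTail_prod {m : ℕ} {h : α → ℝ} (hh : Measurable h) {q : β → ℝ}
    (hq : Measurable q) (ε : ℝ) :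
    MeasurableSet {p : β × (Fin m → α) | p.2 ∈ klUpperTail h (q p.1) ε} := by
  have hmean : Measurable fun p : β × (Fin m → α) => blockMean fun i => h (p.2 i) :=
    (measurable_blockMean_comp hh).comp measurable_snd
  have hq' : Measurable fun p : β × (Fin m → α) => q p.1 := hq.comp measurable_fst
  exact (measurableSet_lt hq' hmean).inter
    (measurableSet_lt measurable_const (measurable_binaryKL hmean hq'))

lemma measurableSet_forall_eval_prod {ι : Type*} [Countable ι] {A : Set (β × α)}
    (hA : MeasurableSet A) : MeasurableSet {p : β × (ι → α) | ∀ k, (p.1, p.2 k) ∈ A} := by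
  rw [Set.ofPred_forall]
  refine MeasurableSet.iInter fun k => ?_
  exact (measurable_fst.prodMk ((measurable_pi_apply k).comp measurable_snd)) hA

end FailureSet

section Procedure

variable {𝒳 Θ : Type*} [MeasurableSpace 𝒳] [MeasurableSpace Θ]

/-- The expected loss `μ_θ` of a parameter. -/
noncomputable def meanLoss (f : Θ → 𝒳 → ℝ) (D : Measure 𝒳) (t : Θ) : ℝ := ∫ x, f t x ∂D

/-- The Krichevsky–Trofimov wealth of a parameter against its true mean. -/
noncomputable def trueWealth (f : Θ → 𝒳 → ℝ) (D : Measure 𝒳) {n : ℕ} (x : Fin n → 𝒳) (t : Θ) :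
    ENNReal :=
  ktWealth (meanLoss f D t) fun i => f t (x i)

/-- The upper bound on the optimal log-wealth against the true mean which the
Krichevsky–Trofimov mixture provides. -/
noncomputable def logWealthBound (f : Θ → 𝒳 → ℝ) (D : Measure 𝒳) {n : ℕ} (x : Fin n → 𝒳) (t : Θ) :
    ENNReal :=
  posLog (ENNReal.ofReal (regret n) * trueWealth f D x t)

/-- The wealth against the true means, averaged over the prior. -/
noncomputable def priorWealth (f : Θ → 𝒳 → ℝ) (D : Measure 𝒳) (P₀ : Measure Θ) {n : ℕ}
    (x : Fin n → 𝒳) : ENNReal :=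
  ∫⁻ t, trueWealth f D x t ∂P₀

/-- A lower bound on `complexity n Q P₀ + ln (1/δ)`. It replaces that quantity in the failure event
because it is measurable in the sample, which is not clear for the divergence of a posterior
kernel from the prior. -/
noncomputable def budget (f : Θ → 𝒳 → ℝ) (D : Measure 𝒳) (Q P₀ : Measure Θ) (δ : ℝ) {n : ℕ}
    (x : Fin n → 𝒳) : ENNReal :=
  max (ENNReal.ofReal (Real.log (1 / δ)))
    (∫⁻ t, logWealthBound f D x t ∂Q - posLog (ENNReal.ofReal δ * priorWealth f D P₀ x))

/-- The draws for which no block certifies the upper output, or no block certifies the lower one: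
a block certifies an output when it is within budget and its mean does not deviate to the wrong
side. -/
def failureSet (f : Θ → 𝒳 → ℝ) (D : Measure 𝒳) (Q P₀ : Measure Θ) (δ : ℝ) {n : ℕ} (K m : ℕ)
    (x : Fin n → 𝒳) : Set (Fin K → Fin m → Θ) :=
  {θ | ∀ k, θ k ∈ overBudget (logWealthBound f D x) (budget f D Q P₀ δ x) ∪
      klLowerTail (meanLoss f D) (∫ t, meanLoss f D t ∂Q) (klRadius δ K m)} ∪
    {θ | ∀ k, θ k ∈ overBudget (logWealthBound f D x) (budget f D Q P₀ δ x) ∪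
      klUpperTail (meanLoss f D) (∫ t, meanLoss f D t ∂Q) (klRadius δ K m)}

variable {f : Θ → 𝒳 → ℝ} {n : ℕ}

section Measurability

variable (D : Measure 𝒳) [SFinite D] (P₀ : Measure Θ) [SFinite P₀]

lemma measurable_meanLoss (hf : Measurable (Function.uncurry f)) : Measurable (meanLoss f D) :=
  (hf.stronglyMeasurable.integral_prod_right' (ν := D)).measurable

lemma measurable_trueWealth (hf : Measurable (Function.uncurry f)) :
    Measurable (Function.uncurry (trueWealth (n := n) f D)) :=
  measurable_ktWealth (y := fun (p : (Fin n → 𝒳) × Θ) i => f p.2 (p.1 i))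
    ((measurable_meanLoss D hf).comp measurable_snd)
    fun i => hf.comp (measurable_snd.prodMk ((measurable_pi_apply i).comp measurable_fst))

lemma measurable_logWealthBound (hf : Measurable (Function.uncurry f)) :
    Measurable (Function.uncurry (logWealthBound (n := n) f D)) :=
  measurable_posLog.comp ((measurable_trueWealth D hf).const_mul _)

lemma measurable_priorWealth (hf : Measurable (Function.uncurry f)) :
    Measurable fun x : Fin n → 𝒳 => priorWealth f D P₀ x :=
  (measurable_trueWealth D hf).lintegral_prod_right'

lemma measurable_budget (hf : Measurable (Function.uncurry f)) (δ : ℝ)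
    (post : Kernel (Fin n → 𝒳) Θ) [IsSFiniteKernel post] :
    Measurable fun x : Fin n → 𝒳 => budget f D (post x) P₀ δ x := by
  have hbound : Measurable fun x : Fin n → 𝒳 => ∫⁻ t, logWealthBound f D x t ∂(post x) :=
    (measurable_logWealthBound D hf).lintegral_kernel_prod_right'
  have hprior := measurable_priorWealth (n := n) D P₀ hf
  unfold budget
  fun_prop

lemma measurableSet_failureSet_prod (hf : Measurable (Function.uncurry f)) (δ : ℝ) (K m : ℕ)
    (post : Kernel (Fin n → 𝒳) Θ) [IsSFiniteKernel post] :
    MeasurableSet {p : (Fin n → 𝒳) × (Fin K → Fin m → Θ) |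
      p.2 ∈ failureSet f D (post p.1) P₀ δ K m p.1} := by
  have hmean := measurable_meanLoss D hf
  have hq : Measurable fun x : Fin n → 𝒳 => ∫ t, meanLoss f D t ∂(post x) :=
    (hmean.comp measurable_snd).stronglyMeasurable.integral_kernel_prod_right'.measurable
  have hover := measurableSet_overBudget_prod (m := m) (measurable_logWealthBound D hf)
    (measurable_budget D P₀ hf δ post)
  exact (measurableSet_forall_eval_prod
    (hover.union (measurableSet_klLowerTail_prod hmean hq (klRadius δ K m)))).union
    (measurableSet_forall_eval_prod
      (hover.union (measurableSet_klUpperTail_prod hmean hq (klRadius δ K m))))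

end Measurability

section Bounds

variable (D : Measure 𝒳) [IsProbabilityMeasure D] (Q P₀ : Measure Θ) [IsProbabilityMeasure Q]
  [IsProbabilityMeasure P₀]

lemma meanLoss_mem_Icc (hf : Measurable (Function.uncurry f))
    (hf01 : ∀ θ x, f θ x ∈ Set.Icc (0 : ℝ) 1) (t : Θ) : meanLoss f D t ∈ Set.Icc (0 : ℝ) 1 :=
  (convex_Icc 0 1).integral_mem isClosed_Icc (.of_forall (hf01 t))
    (.of_mem_Icc 0 1 (hf.comp measurable_prodMk_left).aemeasurable (.of_forall (hf01 t)))

lemma lintegral_priorWealth_le_one (hf : Measurable (Function.uncurry f))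
    (hf01 : ∀ θ x, f θ x ∈ Set.Icc (0 : ℝ) 1) (n : ℕ) :
    ∫⁻ x, priorWealth f D P₀ x ∂(Measure.pi fun _ : Fin n => D) ≤ 1 := by
  unfold priorWealth
  rw [lintegral_lintegral_swap (measurable_trueWealth D hf).aemeasurable]
  calc ∫⁻ t, ∫⁻ x, trueWealth f D x t ∂(Measure.pi fun _ : Fin n => D) ∂P₀
      ≤ ∫⁻ _, 1 ∂P₀ := lintegral_mono fun t =>
        lintegral_ktWealth_le_one D (hf.comp measurable_prodMk_left) (hf01 t)
    _ = 1 := by rw [lintegral_one, measure_univ]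

lemma lintegral_logWealthBound_le (hf : Measurable (Function.uncurry f))
    (hf01 : ∀ θ x, f θ x ∈ Set.Icc (0 : ℝ) 1) {δ : ℝ} (hδ0 : 0 < δ) (hδ1 : δ ≤ 1)
    (x : Fin n → 𝒳) :
    ∫⁻ t, logWealthBound f D x t ∂Q ≤ InformationTheory.klDiv Q P₀ +
      ENNReal.ofReal (Real.log (regret n)) + ENNReal.ofReal (Real.log (1 / δ)) +
        posLog (ENNReal.ofReal δ * priorWealth f D P₀ x) := by
  have hwealth : Measurable (trueWealth f D x) := (measurable_trueWealth D hf).of_uncurry_left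
  have hone (t : Θ) : 1 ≤ ENNReal.ofReal (regret n) * trueWealth f D x t := by
    simpa only [trueWealth, Fintype.card_fin] using
      one_le_regret_mul_ktWealth (meanLoss_mem_Icc D hf hf01 t) fun i => hf01 t (x i)
  have hscale : ENNReal.ofReal (regret n) * ∫⁻ t, trueWealth f D x t ∂P₀ =
      ENNReal.ofReal (regret n * (1 / δ)) * (ENNReal.ofReal δ * priorWealth f D P₀ x) := by
    have := regret_pos n
    rw [← mul_assoc, ← ENNReal.ofReal_mul (by positivity), mul_assoc, one_div_mul_cancel hδ0.ne',
      mul_one, priorWealth]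
  have hlog : posLog (ENNReal.ofReal (regret n * (1 / δ))) =
      ENNReal.ofReal (Real.log (regret n)) + ENNReal.ofReal (Real.log (1 / δ)) := by
    have hδ := one_div_pos.2 hδ0
    rw [posLog_ofReal (mul_pos (regret_pos n) hδ), Real.log_mul (regret_pos n).ne' hδ.ne',
      ENNReal.ofReal_add (Real.log_nonneg (one_le_regret n))
        (Real.log_nonneg ((one_le_div hδ0).2 hδ1))]
  calc ∫⁻ t, logWealthBound f D x t ∂Q
      ≤ InformationTheory.klDiv Q P₀ +
          posLog (∫⁻ t, ENNReal.ofReal (regret n) * trueWealth f D x t ∂P₀) :=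
        lintegral_posLog_le_klDiv_add_posLog Q P₀ (hwealth.const_mul _) hone
    _ ≤ InformationTheory.klDiv Q P₀ + (posLog (ENNReal.ofReal (regret n * (1 / δ))) +
          posLog (ENNReal.ofReal δ * priorWealth f D P₀ x)) := by
        rw [lintegral_const_mul _ hwealth, hscale]
        gcongr
        exact posLog_mul_le _ _
    _ = _ := by rw [hlog, add_assoc, add_assoc, add_assoc]

lemma budget_le_complexity (hf : Measurable (Function.uncurry f))
    (hf01 : ∀ θ x, f θ x ∈ Set.Icc (0 : ℝ) 1) {δ : ℝ} (hδ0 : 0 < δ) (hδ1 : δ ≤ 1)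
    (x : Fin n → 𝒳) :
    (budget f D Q P₀ δ x : EReal) ≤ complexity n Q P₀ + ((Real.log (1 / δ) : ℝ) : EReal) := by
  have hregret : 0 ≤ Real.log (regret n) := Real.log_nonneg (one_le_regret n)
  have hlog : 0 ≤ Real.log (1 / δ) := Real.log_nonneg ((one_le_div hδ0).2 hδ1)
  have hcoe : complexity n Q P₀ + ((Real.log (1 / δ) : ℝ) : EReal) =
      ((InformationTheory.klDiv Q P₀ + ENNReal.ofReal (Real.log (regret n)) +
        ENNReal.ofReal (Real.log (1 / δ)) : ENNReal) : EReal) := by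
    rw [EReal.coe_ennreal_add, EReal.coe_ennreal_add, EReal.coe_ennreal_ofReal,
      EReal.coe_ennreal_ofReal, max_eq_left hregret, max_eq_left hlog]
    rfl
  rw [hcoe, EReal.coe_ennreal_le_coe_ennreal_iff]
  exact max_le le_add_self
    (tsub_le_iff_right.2 (lintegral_logWealthBound_le D Q P₀ hf hf01 hδ0 hδ1 x))

lemma sum_optLogWealth_le_sum_logWealthBound (hf : Measurable (Function.uncurry f))
    (hf01 : ∀ θ x, f θ x ∈ Set.Icc (0 : ℝ) 1) {m : ℕ} (x : Fin n → 𝒳) (θ : Fin m → Θ) :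
    ∑ i, optLogWealth f x (θ i) (meanLoss f D (θ i)) ≤
      ((∑ i, logWealthBound f D x (θ i) : ENNReal) : EReal) := by
  have hcoe : ((∑ i, logWealthBound f D x (θ i) : ENNReal) : EReal) =
      ∑ i, (logWealthBound f D x (θ i) : EReal) :=
    map_sum (⟨⟨(↑), EReal.coe_ennreal_zero⟩, EReal.coe_ennreal_add⟩ : ENNReal →+ EReal) _ _
  rw [hcoe]
  exact Finset.sum_le_sum fun i _ => (optLogWealth_le_log_regret_mul_ktWealth hf01 x (θ i)
    (meanLoss_mem_Icc D hf hf01 _)).trans (log_le_posLog _)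

lemma meanLoss_mem_feasible_of_notMem_overBudget (hf : Measurable (Function.uncurry f))
    (hf01 : ∀ θ x, f θ x ∈ Set.Icc (0 : ℝ) 1) {δ : ℝ} (hδ0 : 0 < δ) (hδ1 : δ ≤ 1) {m : ℕ}
    (hm : 0 < m) {x : Fin n → 𝒳} {θ : Fin m → Θ}
    (hθ : θ ∉ overBudget (logWealthBound f D x) (budget f D Q P₀ δ x)) :
    (fun i => meanLoss f D (θ i)) ∈ feasible f Q P₀ δ x θ := by
  refine ⟨fun i => meanLoss_mem_Icc D hf hf01 _, ?_⟩
  have hc : 0 < Real.exp 1 * (m : ℝ) := mul_pos (Real.exp_pos 1) (mod_cast hm)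
  have hc_inv : 0 ≤ 1 / (Real.exp 1 * (m : ℝ)) := one_div_nonneg.2 hc.le
  have hc_coe : ((1 / (Real.exp 1 * (m : ℝ)) : ℝ) : EReal) =
      (ENNReal.ofReal (1 / (Real.exp 1 * m)) : EReal) := by
    rw [EReal.coe_ennreal_ofReal, max_eq_left hc_inv]
  have hsum : ∑ i, optLogWealth f x (θ i) (meanLoss f D (θ i)) ≤
      ((ENNReal.ofReal (Real.exp 1 * m) * budget f D Q P₀ δ x : ENNReal) : EReal) :=
    (sum_optLogWealth_le_sum_logWealthBound D hf hf01 x θ).trans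
      (EReal.coe_ennreal_le_coe_ennreal_iff.2 (not_lt.1 hθ))
  calc ((1 / (Real.exp 1 * (m : ℝ)) : ℝ) : EReal) *
        ∑ i, optLogWealth f x (θ i) (meanLoss f D (θ i))
      ≤ ((1 / (Real.exp 1 * (m : ℝ)) : ℝ) : EReal) *
          ((ENNReal.ofReal (Real.exp 1 * m) * budget f D Q P₀ δ x : ENNReal) : EReal) :=
        mul_le_mul_of_nonneg_left hsum (mod_cast hc_inv)
    _ = (budget f D Q P₀ δ x : EReal) := by
        rw [hc_coe, ← EReal.coe_ennreal_mul, ← mul_assoc, ← ENNReal.ofReal_mul hc_inv,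
          one_div_mul_cancel hc.ne', ENNReal.ofReal_one, one_mul]
    _ ≤ _ := budget_le_complexity D Q P₀ hf hf01 hδ0 hδ1 x

lemma outputs_of_notMem_failureSet (hf : Measurable (Function.uncurry f))
    (hf01 : ∀ θ x, f θ x ∈ Set.Icc (0 : ℝ) 1) {δ : ℝ} (hδ0 : 0 < δ) (hδ1 : δ ≤ 1) {K m : ℕ}
    (hm : 0 < m) (hr : 0 ≤ klRadius δ K m) {x : Fin n → 𝒳} {θ : Fin K → Fin m → Θ}
    (hθ : θ ∉ failureSet f D Q P₀ δ K m x) :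
    lowerOutput f Q P₀ δ x θ ≤ ∫ t, meanLoss f D t ∂Q ∧
      ∫ t, meanLoss f D t ∂Q ≤ upperOutput f Q P₀ δ x θ := by
  have hq : ∫ t, meanLoss f D t ∂Q ∈ Set.Icc (0 : ℝ) 1 :=
    have hmean := meanLoss_mem_Icc D hf hf01
    (convex_Icc 0 1).integral_mem isClosed_Icc (.of_forall hmean)
      (.of_mem_Icc 0 1 (measurable_meanLoss D hf).aemeasurable (.of_forall hmean))
  rw [failureSet, Set.mem_union, not_or] at hθ
  obtain ⟨k, hk⟩ := not_forall.1 hθ.1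
  obtain ⟨j, hj⟩ := not_forall.1 hθ.2
  rw [Set.mem_union, not_or] at hk hj
  exact ⟨lowerOutput_le hr hq.1
      (meanLoss_mem_feasible_of_notMem_overBudget D Q P₀ hf hf01 hδ0 hδ1 hm hj.1) hj.2,
    le_upperOutput hr hq.2
      (meanLoss_mem_feasible_of_notMem_overBudget D Q P₀ hf hf01 hδ0 hδ1 hm hk.1) hk.2⟩

end Bounds

lemma measure_failureSet_le (D : Measure 𝒳) [IsProbabilityMeasure D] (Q P₀ : Measure Θ)
    [IsProbabilityMeasure Q] (hf : Measurable (Function.uncurry f))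
    (hf01 : ∀ θ x, f θ x ∈ Set.Icc (0 : ℝ) 1) {δ : ℝ} (hδ0 : 0 < δ) (hδ1 : δ < 1) {K m : ℕ}
    (hK : 0 < K) (hm : 0 < m) (hr : 0 ≤ klRadius δ K m) {x : Fin n → 𝒳} {w : ℝ} (hw : 0 ≤ w)
    (hxw : priorWealth f D P₀ x = ENNReal.ofReal w) :
    (Measure.pi fun _ : Fin K => Measure.pi fun _ : Fin m => Q).real
        (failureSet f D Q P₀ δ K m x) ≤
      min 1 (2 * (overBudgetBound δ w + 2 * δ / K) ^ K - overBudgetBound δ w ^ K) := by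
  have hlog : 0 < Real.log (1 / δ) := Real.log_pos ((one_lt_div hδ0).2 hδ1)
  have hbound : Measurable (logWealthBound f D x) :=
    (measurable_logWealthBound D hf).of_uncurry_left
  have hbudget : ∫⁻ t, logWealthBound f D x t ∂Q ≤
      budget f D Q P₀ δ x + ENNReal.ofReal (Real.posLog (δ * w)) := by
    rw [← posLog_ofReal_eq_ofReal_posLog (mul_nonneg hδ0.le hw), ENNReal.ofReal_mul hδ0.le, ← hxw]
    exact tsub_le_iff_right.1 (le_max_right _ _)
  have hover : MeasurableSet
      (overBudget (logWealthBound f D x) (budget f D Q P₀ δ x) : Set (Fin m → Θ)) :=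
    measurableSet_lt measurable_const (by fun_prop)
  have hp := measure_overBudget_le Q hbound hm hlog (le_max_left _ _) Real.posLog_nonneg hbudget
  have hmean := measurable_meanLoss D hf
  have hmean01 := meanLoss_mem_Icc D hf hf01
  have hunion := measureReal_pi_forall_mem_union_le (ι := Fin K) _ hover hp
    (measure_klLowerTail_le Q hmean hmean01 hm hr) (measure_klUpperTail_le Q hmean hmean01 hm hr)
  rw [exp_neg_mul_klRadius hδ0 hK hm, Fintype.card_fin] at hunion
  exact le_min measureReal_le_one hunion

lemma compProd_failureSet_le (D : Measure 𝒳) [IsProbabilityMeasure D] (P₀ : Measure Θ)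
    [IsProbabilityMeasure P₀] (hf : Measurable (Function.uncurry f))
    (hf01 : ∀ θ x, f θ x ∈ Set.Icc (0 : ℝ) 1) {δ : ℝ} (hδ0 : 0 < δ) (hδ3 : δ < 1 / 3) {K m : ℕ}
    (hK : K = ⌈Real.log (1 / δ)⌉₊) (hm : 0 < m) (hr : 0 ≤ klRadius δ K m)
    (post : Kernel (Fin n → 𝒳) Θ) [IsMarkovKernel post] :
    ((Measure.pi fun _ : Fin n => D) ⊗ₘ iidKernel (iidKernel post m) K)
      {p | p.2 ∈ failureSet f D (post p.1) P₀ δ K m p.1} ≤ ENNReal.ofReal (3 * δ) := by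
  obtain ⟨c₀, c₁, hc₀, hc₁, hc, hmaj⟩ := exists_affine_majorant hδ0 hδ3 hK
  have hK0 : 0 < K := two_pos.trans_le (hK ▸ two_le_ceil_log_one_div hδ0 hδ3)
  have hwealth := measurable_priorWealth (n := n) D P₀ hf
  have hwealth1 := lintegral_priorWealth_le_one D P₀ hf hf01 n
  have hcond (x : Fin n → 𝒳) (hx : priorWealth f D P₀ x < ⊤) :
      (Measure.pi fun _ : Fin K => Measure.pi fun _ : Fin m => post x)
        (failureSet f D (post x) P₀ δ K m x) ≤
          ENNReal.ofReal c₀ + ENNReal.ofReal c₁ * priorWealth f D P₀ x := by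
    obtain ⟨w, hw, hxw⟩ : ∃ w : ℝ, 0 ≤ w ∧ priorWealth f D P₀ x = ENNReal.ofReal w :=
      ⟨_, ENNReal.toReal_nonneg, (ENNReal.ofReal_toReal hx.ne).symm⟩
    rw [hxw, ← ENNReal.ofReal_mul hc₁, ← ENNReal.ofReal_add hc₀ (mul_nonneg hc₁ hw),
      ← ofReal_measureReal]
    exact ENNReal.ofReal_le_ofReal ((measure_failureSet_le D (post x) P₀ hf hf01 hδ0
      (by linarith) hK0 hm hr hw hxw).trans (hmaj w hw))
  rw [Measure.compProd_apply (measurableSet_failureSet_prod D P₀ hf δ K m post)]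
  calc _ ≤ ∫⁻ x, (ENNReal.ofReal c₀ + ENNReal.ofReal c₁ * priorWealth f D P₀ x)
          ∂(Measure.pi fun _ : Fin n => D) := by
        refine lintegral_mono_ae ?_
        filter_upwards [ae_lt_top hwealth (hwealth1.trans_lt ENNReal.one_lt_top).ne] with x hx
        exact hcond x hx
    _ = ENNReal.ofReal c₀ + ENNReal.ofReal c₁ *
          ∫⁻ x, priorWealth f D P₀ x ∂(Measure.pi fun _ : Fin n => D) := by
        rw [lintegral_add_left measurable_const, lintegral_const_mul _ hwealth, lintegral_const,
          measure_univ, mul_one]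
    _ ≤ ENNReal.ofReal c₀ + ENNReal.ofReal c₁ * 1 := by gcongr
    _ = ENNReal.ofReal (c₀ + c₁) := by rw [mul_one, ENNReal.ofReal_add hc₀ hc₁]
    _ ≤ ENNReal.ofReal (3 * δ) := ENNReal.ofReal_le_ofReal hc

end Procedure

lemma exists_measurableSet_forall_notMem_of_hasLaw {Ω α : Type*} [MeasurableSpace Ω]
    [MeasurableSpace α] {P : Measure Ω} [IsProbabilityMeasure P] {ρ : Measure α} {Z : Ω → α}
    (hZ : HasLaw Z ρ P) {F : Set α} (hF : MeasurableSet F) {c : ℝ} (hc : 0 ≤ c)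
    (hρ : ρ F ≤ ENNReal.ofReal c) :
    ∃ E, MeasurableSet E ∧ ENNReal.ofReal (1 - c) ≤ P E ∧ ∀ ω ∈ E, Z ω ∉ F := by
  refine ⟨(toMeasurable P (Z ⁻¹' F))ᶜ, (measurableSet_toMeasurable _ _).compl, ?_,
    fun ω hω hF => hω (subset_toMeasurable _ _ hF)⟩
  rw [prob_compl_eq_one_sub (measurableSet_toMeasurable _ _), measure_toMeasurable,
    ← Measure.map_apply_of_aemeasurable hZ.aemeasurable hF, hZ.map_eq, ENNReal.ofReal_sub _ hc,
    ENNReal.ofReal_one]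
  exact tsub_le_tsub_left hρ 1

end PacBayes

/-- The sample `X₁, …, Xₙ` is i.i.d. with law `D`, the posterior is `P_n = post (X₁, …, Xₙ)`, and,
given the sample, the `K` blocks of parameters are independent draws from `P_n^m`. -/
theorem proposition5 {𝒳 Θ Ω : Type*} [MeasurableSpace 𝒳] [MeasurableSpace Θ] [MeasurableSpace Ω]
    (P : Measure Ω) [IsProbabilityMeasure P]
    (D : Measure 𝒳) [IsProbabilityMeasure D]
    (P₀ : Measure Θ) [IsProbabilityMeasure P₀]
    (f : Θ → 𝒳 → ℝ) (hf : Measurable (Function.uncurry f))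
    (hf01 : ∀ θ x, f θ x ∈ Set.Icc (0 : ℝ) 1)
    (n : ℕ) (X : Fin n → Ω → 𝒳) (hX : ∀ i, HasLaw (X i) D P) (hXindep : iIndepFun X P)
    (post : Kernel (Fin n → 𝒳) Θ) [IsMarkovKernel post]
    (δ : ℝ) (hδ0 : 0 < δ) (hδ1 : δ ≤ 1)
    (K : ℕ) (hK : K = ⌈Real.log (1 / δ)⌉₊) (m : ℕ) (hm : 0 < m)
    (θ : Ω → Fin K → Fin m → Θ)
    (hθ : HasCondDistrib θ (fun ω i => X i ω)
      (PacBayes.iidKernel (PacBayes.iidKernel post m) K) P) :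
    ∃ E : Set Ω, MeasurableSet E ∧ ENNReal.ofReal (1 - 3 * δ) ≤ P E ∧
      ∀ ω ∈ E,
        PacBayes.lowerOutput f (post fun i => X i ω) P₀ δ (fun i => X i ω) (θ ω) ≤
            ∫ t, (∫ x, f t x ∂D) ∂(post fun i => X i ω) ∧
          ∫ t, (∫ x, f t x ∂D) ∂(post fun i => X i ω) ≤
            PacBayes.upperOutput f (post fun i => X i ω) P₀ δ (fun i => X i ω) (θ ω) := by
  rcases le_or_gt (1 / 3) δ with hδ3 | hδ3
  · refine ⟨∅, .empty, ?_, fun ω hω => absurd hω (Set.notMem_empty ω)⟩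
    rw [ENNReal.ofReal_of_nonpos (by linarith)]
    exact zero_le
  have hK2 : 2 ≤ K := hK ▸ PacBayes.two_le_ceil_log_one_div hδ0 hδ3
  have hr : 0 ≤ PacBayes.klRadius δ K m :=
    PacBayes.klRadius_nonneg hδ0 (by linarith [(Nat.ofNat_le_cast (α := ℝ)).2 hK2]) m
  have hlaw := (hXindep.hasLaw_pi hX).prodMk_of_hasCondDistrib hθ
  obtain ⟨E, hE, hPE, hmem⟩ := PacBayes.exists_measurableSet_forall_notMem_of_hasLaw hlaw
    (PacBayes.measurableSet_failureSet_prod D P₀ hf δ K m post) (by positivity)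
    (PacBayes.compProd_failureSet_le D P₀ hf hf01 hδ0 hδ3 hK hm hr post)
  exact ⟨E, hE, hPE, fun ω hω => PacBayes.outputs_of_notMem_failureSet D _ P₀ hf hf01 hδ0 hδ1 hm hr
    (hmem ω hω)⟩
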